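/- Let $n\ge 1$. Let $\mathrm{Conv}_c(\mathbb R^n)$ be the set of convex, lower semicontinuous functions $\psi:\mathbb R^n\to(-\infty,+\infty]$ with $\psi\not\equiv+\infty$ and $\lim_{\|x\|\to\infty}\psi(x)=+\infty$. For a unit vector $u$ put $R_u(x)=x-2\langle x,u\rangle u$ and $R_uf=f\circ R_u$. The Minkowski symmetral of $\psi$ is $$(\tau_u\psi)(x)=\inf_{y+z=x}\left\{\tfrac12\psi(2y)+\tfrac12(R_u\psi)(2z)\right\}.$$ A sequence $\psi_j$ epi-converges to $\psi$ if for every $x$: $\psi(x)\le\liminf_j\psi_j(x_j)$ for every sequence $x_j\to x$, and $\psi(x)=\lim_j\psi_j(x_j)$ for at least one sequence $x_j\to x$; $f_j$ hypo-converges to $f$ if $-f_j$ epi-converges to $-f$. A function on $\mathbb R^n$ is called rotation invariant if it is invariant under all linear isometries. (1) For every $\psi\in\mathrm{Conv}_c(\mathbb R^n)$ there are unit vectors $u_1,u_2,\dots$ such that $\tau_{u_m}\cdots\tau_{u_1}\psi$ epi-converges, as $m\to\infty$, to a rotation-invariant function $\psi_{\rm sym}\in\mathrm{Conv}_c(\mathbb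 R^n)$. Every function $\psi_{\rm sym}$ arising in this way is called an epi-symmetrization of $\psi$. (2) Let $\alpha\in\mathbb R$. A function $f:\mathbb R^n\to[0,\infty)$ is $\alpha$-concave if $\operatorname{supp} f=\{f>0\}$ is convex and $f(\lambda x+(1-\lambda)y)\ge(\lambda f(x)^\alpha+(1-\lambda)f(y)^\alpha)^{1/\alpha}$ (read as $f(x)^\lambda f(y)^{1-\lambda}$ if $\alpha=0$) for all $x,y\in\operatorname{supp} f$ and $\lambda\in[0,1]$. Let $\mathcal C_\alpha(\mathbb R^n)$ be the set of $\alpha$-concave, upper semicontinuous $f\not\equiv0$ with $\dim(\operatorname{supp} f)=n$ and $\lim_{\|x\|\to\infty}f(x)=0$. The base function of $f$ is $\mathrm{base}_\alpha f=(1-f^\alpha)/\alpha$ for $\alpha\ne0$ and $\mathrm{base}_0f=-\log f$, with the value $+\infty$ at the zeros of $f$ if $\alpha\le 0$, and with the value $+\infty$ off the closure of $\operatorname{supp} f$ if $\alpha>0$. Conversely a function $\psi$ determines $(1-\alpha\psi)_+^{1/\alpha}$ (read as $e^{-\psi}$ if $\alpha=0$, and as $0$ where $\psi=+\infty$). The $\alpha$-Asplund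 sum $f\star_\alpha g$ and the homothety $\lambda\cdot_\alpha f$ are the functions determined by the infimal convolution of $\mathrm{base}_\alpha f$ and $\mathrm{base}_\alpha g$ and by $x\mapsto\lambda\,(\mathrm{base}_\alpha f)(x/\lambda)$, respectively, and the $\alpha$-Minkowski symmetral of $f$ is $\tau^\alpha_uf=\frac12\cdot_\alpha f\star_\alpha\frac12\cdot_\alpha R_uf$. A hypo-symmetrization of $f$ is a function $f_{\rm sym}=(1-\alpha\psi_{\rm sym})_+^{1/\alpha}$ with $\psi_{\rm sym}$ an epi-symmetrization of $\mathrm{base}_\alpha f$. Every $f\in\mathcal C_\alpha(\mathbb R^n)$ has a hypo-symmetrization, and every hypo-symmetrization $f_{\rm sym}$ of $f$ is rotation invariant, belongs to $\mathcal C_\alpha(\mathbb R^n)$, and is the hypo-limit of $\tau^\alpha_{u_m}\cdots\tau^\alpha_{u_1}f$ for some sequence of unit vectors $u_1,u_2,\dots$. For $\alpha=0$ the same holds with $\mathcal C_0(\mathbb R^n)$ replaced by $\mathrm{LC}_c(\mathbb R^n)=\{e^{-\psi}:\psi\in\mathrm{Conv}_c(\mathbb R^n)\}$. -/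

import Mathlib

open Filter Topology

namespace MinkSymm

noncomputable section

/-- `ℝⁿ` with its Euclidean structure. -/
abbrev E (n : ℕ) : Type := EuclideanSpace ℝ (Fin n)

variable {n : ℕ}

/-! ### Extended-real-valued convex functions -/

/-- The class `Conv_c(ℝⁿ)`: functions `ℝⁿ → (-∞, +∞]` that are convex (convex epigraph), proper,
lower semicontinuous and coercive. -/
structure IsConvC (ψ : E n → EReal) : Prop where
  convex : Convex ℝ {p : E n × ℝ | ψ p.1 ≤ (p.2 : EReal)}
  ne_bot : ∀ x, ψ x ≠ ⊥
  dom_nonempty : ∃ x, ψ x ≠ ⊤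
  lsc : LowerSemicontinuous ψ
  coercive : Tendsto ψ (cocompact (E n)) (𝓝 ⊤)

/-- Infimal convolution `(φ □ ψ)(x) = inf_{y + z = x} (φ(y) + ψ(z))`. -/
def infConv (φ ψ : E n → EReal) (x : E n) : EReal := ⨅ y : E n, φ y + ψ (x - y)

/-- Epi-multiplication `x ↦ c ψ(x / c)` (used for `c > 0`). -/
def epiMul (c : ℝ) (ψ : E n → EReal) (x : E n) : EReal := (c : EReal) * ψ (c⁻¹ • x)

/-- The reflection `R_u(x) = x - 2⟨x, u⟩u` about the hyperplane `u^⊥` (`u` a unit vector). -/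
def reflect (u x : E n) : E n := x - (2 * inner ℝ x u) • u

/-- The reflection `R_u f = f ∘ R_u` of a function. -/
def reflectFun {β : Type*} (u : E n) (f : E n → β) (x : E n) : β := f (reflect u x)

/-- The Minkowski symmetral `τ_u ψ` of a convex function. -/
def symmetral (u : E n) (ψ : E n → EReal) : E n → EReal :=
  infConv (epiMul (1 / 2) ψ) (epiMul (1 / 2) (reflectFun u ψ))

/-- Successive Minkowski symmetrals: `iterSymmetral u ψ m = τ_{u (m-1)} ⋯ τ_{u 0} ψ`. -/
def iterSymmetral (u : ℕ → E n) (ψ : E n → EReal) : ℕ → E n → EReal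
  | 0 => ψ
  | m + 1 => symmetral (u m) (iterSymmetral u ψ m)

/-- Epi-convergence of a sequence of extended-real-valued functions. -/
def EpiConverges (ψs : ℕ → E n → EReal) (ψ : E n → EReal) : Prop :=
  ∀ x : E n,
    (∀ xs : ℕ → E n, Tendsto xs atTop (𝓝 x) →
      ψ x ≤ liminf (fun j => ψs j (xs j)) atTop) ∧
    ∃ xs : ℕ → E n, Tendsto xs atTop (𝓝 x) ∧
      Tendsto (fun j => ψs j (xs j)) atTop (𝓝 (ψ x))

/-- Invariance under all linear isometries of `ℝⁿ`. -/
def RotationInvariant {β : Type*} (f : E n → β) : Prop :=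
  ∀ (T : E n ≃ₗᵢ[ℝ] E n) (x : E n), f (T x) = f x

/-- `φ` is an epi-symmetrization `ψ_sym` of `ψ`: a rotation-invariant member of `Conv_c(ℝⁿ)` which
is the epi-limit of successive Minkowski symmetrals of `ψ`. -/
def IsEpiSymmetrization (ψ φ : E n → EReal) : Prop :=
  IsConvC φ ∧ RotationInvariant φ ∧
    ∃ u : ℕ → E n, (∀ i, ‖u i‖ = 1) ∧ EpiConverges (iterSymmetral u ψ) φ

/-! ### `α`-concave functions -/

/-- The `α`-mean `M_α^{(s,t)}(a,b)` for real `α` and `a, b > 0`. -/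
def alphaMean (α s t a b : ℝ) : ℝ :=
  if α = 0 then a ^ s * b ^ t else (s * a ^ α + t * b ^ α) ^ (1 / α)

/-- `α`-concavity of a nonnegative function, with support `{f ≠ 0} = {f > 0}`. -/
def AlphaConcave (α : ℝ) (f : E n → ℝ) : Prop :=
  Convex ℝ (Function.support f) ∧
    ∀ x ∈ Function.support f, ∀ y ∈ Function.support f, ∀ t ∈ Set.Icc (0 : ℝ) 1,
      alphaMean α t (1 - t) (f x) (f y) ≤ f (t • x + (1 - t) • y)

/-- The class `C_α(ℝⁿ)`. -/
structure IsAlphaClass (α : ℝ) (f : E n → ℝ) : Prop where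
  nonneg : ∀ x, 0 ≤ f x
  concave : AlphaConcave α f
  proper : ∃ x, f x ≠ 0
  usc : UpperSemicontinuous f
  full_dim : affineSpan ℝ (Function.support f) = ⊤
  vanish : Tendsto f (cocompact (E n)) (𝓝 0)

/-- The base function `base_α f`: `(1 - f^α)/α` for `α ≠ 0` and `-log f` for `α = 0`.
Where `f = 0` and `α ≤ 0` the value is `+∞`. For `α > 0` the value is `+∞` off the closure of the
support of `f` (so that the base function of the characteristic function of a convex body `K` is `0`
on `K` and `+∞` off `K`), and `1/α` at the zeros of `f` in that closure, as lower semicontinuity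
requires. -/
def baseFn (α : ℝ) (f : E n → ℝ) (x : E n) : EReal :=
  open Classical in
  if 0 < α then
    if x ∈ closure (Function.support f) then (((1 - f x ^ α) / α : ℝ) : EReal) else ⊤
  else if f x = 0 then ⊤
  else if α = 0 then ((-Real.log (f x) : ℝ) : EReal)
  else (((1 - f x ^ α) / α : ℝ) : EReal)

/-- The function `(1 - αψ)_+^{1/α}` with base function `ψ`, read as `e^{-ψ}` for `α = 0`; it
vanishes where `ψ = +∞`. For `α < 0` it is meant for `ψ > 1/α`, where the power is finite. -/
def ofBase (α : ℝ) (ψ : E n → EReal) (x : E n) : ℝ :=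
  open Classical in
  if ψ x = ⊤ then 0
  else if α = 0 then Real.exp (-(ψ x).toReal)
  else (max (1 - α * (ψ x).toReal) 0) ^ (1 / α)

/-- The `α`-Asplund sum `f ⋆_α g`, whose base function is `base_α f □ base_α g`. -/
def asplund (α : ℝ) (f g : E n → ℝ) : E n → ℝ :=
  ofBase α (infConv (baseFn α f) (baseFn α g))

/-- The `(α, c)`-homothety `c ·_α f`, whose base function is the epi-multiple of `base_α f`. -/
def homothety (α c : ℝ) (f : E n → ℝ) : E n → ℝ :=
  ofBase α (epiMul c (baseFn α f))

/-- The `α`-Minkowski symmetral `τ_u^α f = ½ ·_α f ⋆_α ½ ·_α R_u f`. -/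
def alphaSymmetral (α : ℝ) (u : E n) (f : E n → ℝ) : E n → ℝ :=
  asplund α (homothety α (1 / 2) f) (homothety α (1 / 2) (reflectFun u f))

/-- Successive `α`-Minkowski symmetrals: `τ^α_{u (m-1)} ⋯ τ^α_{u 0} f`. -/
def iterAlphaSymmetral (α : ℝ) (u : ℕ → E n) (f : E n → ℝ) : ℕ → E n → ℝ
  | 0 => f
  | m + 1 => alphaSymmetral α (u m) (iterAlphaSymmetral α u f m)

/-- Hypo-convergence of real-valued functions; the upper limit is taken in `[-∞, +∞]`. -/
def HypoConverges (fs : ℕ → E n → ℝ) (f : E n → ℝ) : Prop :=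
  ∀ x : E n,
    (∀ xs : ℕ → E n, Tendsto xs atTop (𝓝 x) →
      limsup (fun j => ((fs j (xs j) : ℝ) : EReal)) atTop ≤ ((f x : ℝ) : EReal)) ∧
    ∃ xs : ℕ → E n, Tendsto xs atTop (𝓝 x) ∧
      Tendsto (fun j => fs j (xs j)) atTop (𝓝 (f x))

/-- `g` is a hypo-symmetrization `f_sym = (1 - α ψ_sym)_+^{1/α}` of `f`, where `ψ_sym` is an
epi-symmetrization of the base function of `f`. -/
def IsHypoSymmetrization (α : ℝ) (f g : E n → ℝ) : Prop :=
  ∃ φ : E n → EReal, IsEpiSymmetrization (baseFn α f) φ ∧ g = ofBase α φ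

/-- The class `LC_c(ℝⁿ)` of functions `e^{-ψ}` with `ψ ∈ Conv_c(ℝⁿ)`. -/
def IsLCc (f : E n → ℝ) : Prop := ∃ ψ : E n → EReal, IsConvC ψ ∧ f = ofBase 0 ψ

end

end MinkSymm

open MinkSymm

/-! Legendre conjugation turns the Minkowski symmetral into the pointwise average of h and h ∘ R_u
(`conj_symmetral`), so reflections must be found along which the averages of h = ψ* become radial.
Coercivity gives ψ linear growth, hence h is finite on a ball about 0; on balls strictly inside its
region of finiteness h is Lipschitz, and averaging keeps the Lipschitz constant.

If h oscillates by more than ε on a sphere, it is well below its maximum on a cap of fixed size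
about a minimum point. A bounded number of reflections carries this cap over the whole sphere and
lowers the maximum by a fixed amount, so finitely many rounds bring the oscillation below ε. Beyond
the radius of finiteness h is infinite on a cap, and the same device spreads the value +∞ over the
sphere. Both effects survive further averaging, so one sequence of reflections serves all radii and
tolerances (`exists_symmetrizing_seq`). The averages are then uniformly Cauchy on the inner balls,
their limit H is radial, and ψ_sym is the conjugate of H. Epi-convergence is recovered from
convergence of the conjugates by a Hahn–Banach argument (`exists_conj_le`,
`epiConverges_radialConj`).

For α-concave functions everything is transported through the decreasing scalar function `profile`.
Base functions belong to a class `IsBase`, stable under symmetrization, on which passing to the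
determined function and back loses nothing; so α-symmetrals correspond to symmetrals of base
functions, and continuity of `profile` turns epi-limits into hypo-limits. Full dimension survives
because a ball on which the base function stays below the vanishing level persists under
symmetrization with the same radius. -/

namespace MinkSymm

/-! ### Reflections in hyperplanes -/

section Reflection

variable {n : ℕ}

lemma reflect_add (u x y : E n) : reflect u (x + y) = reflect u x + reflect u y := by
  simp only [reflect, inner_add_left, mul_add, add_smul]
  abel

lemma reflect_smul (u : E n) (c : ℝ) (x : E n) : reflect u (c • x) = c • reflect u x := by
  simp only [reflect, real_inner_smul_left, smul_sub, smul_smul]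
  congr 2
  ring

lemma reflect_sub (u x y : E n) : reflect u (x - y) = reflect u x - reflect u y := by
  simp only [reflect, inner_sub_left, mul_sub, sub_smul]
  abel

lemma inner_reflect_left (u x y : E n) : inner ℝ (reflect u x) y = inner ℝ x (reflect u y) := by
  simp only [reflect, inner_sub_left, inner_sub_right, real_inner_smul_left,
    real_inner_smul_right, real_inner_comm u y]
  ring

lemma reflect_reflect {u : E n} (hu : ‖u‖ = 1) (x : E n) : reflect u (reflect u x) = x := by
  have h : inner ℝ u u = (1 : ℝ) := by rw [real_inner_self_eq_norm_sq, hu]; norm_num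
  simp only [reflect, inner_sub_left, real_inner_smul_left, h]
  rw [sub_sub, ← add_smul]
  ring_nf
  simp

lemma norm_reflect {u : E n} (hu : ‖u‖ = 1) (x : E n) : ‖reflect u x‖ = ‖x‖ := by
  have : inner ℝ (reflect u x) (reflect u x) = inner ℝ x x := by
    rw [inner_reflect_left, reflect_reflect hu]
  rw [real_inner_self_eq_norm_sq, real_inner_self_eq_norm_sq] at this
  exact (sq_eq_sq₀ (norm_nonneg _) (norm_nonneg _)).1 this

lemma dist_reflect {u : E n} (hu : ‖u‖ = 1) (x y : E n) :
    dist (reflect u x) (reflect u y) = dist x y := by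
  rw [dist_eq_norm, dist_eq_norm, ← reflect_sub, norm_reflect hu]

lemma continuous_reflect (u : E n) : Continuous (reflect u) := by
  unfold reflect
  fun_prop

lemma exists_norm_eq_one (hn : 0 < n) : ∃ u : E n, ‖u‖ = 1 :=
  ⟨EuclideanSpace.single ⟨0, hn⟩ 1, by simp⟩

/-- Any point of a sphere is carried to any other one by a reflection. -/
lemma exists_reflect_eq {p q : E n} (h : ‖p‖ = ‖q‖) (hpq : q ≠ p) :
    ∃ u : E n, ‖u‖ = 1 ∧ reflect u q = p := by
  have h0 : ‖q - p‖ ≠ 0 := by rwa [norm_ne_zero_iff, sub_ne_zero]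
  refine ⟨‖q - p‖⁻¹ • (q - p), by rw [norm_smul, norm_inv, norm_norm, inv_mul_cancel₀ h0], ?_⟩
  have h1 : 2 * inner ℝ q (q - p) = ‖q - p‖ ^ 2 := by
    rw [@norm_sub_sq_real, inner_sub_right, real_inner_self_eq_norm_sq, h]
    ring
  rw [reflect, real_inner_smul_right, smul_smul]
  have : 2 * (‖q - p‖⁻¹ * inner ℝ q (q - p)) * ‖q - p‖⁻¹ = 1 := by
    calc _ = (2 * inner ℝ q (q - p)) * (‖q - p‖⁻¹) ^ 2 := by ring
      _ = 1 := by rw [h1]; field_simp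
  rw [this]
  simp

end Reflection

/-! ### Minkowski symmetrals and growth of convex functions -/

section Symmetral

variable {n : ℕ}

lemma exists_coe_of_ne {a : EReal} (h1 : a ≠ ⊥) (h2 : a ≠ ⊤) : ∃ p : ℝ, a = p :=
  ⟨a.toReal, (EReal.coe_toReal h2 h1).symm⟩

lemma half_mul_coe (p : ℝ) : ((1 / 2 : ℝ) : EReal) * (p : EReal) = ((p / 2 : ℝ) : EReal) := by
  rw [← EReal.coe_mul]
  congr 1
  ring

lemma half_mul_top : ((1 / 2 : ℝ) : EReal) * ⊤ = ⊤ :=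
  EReal.coe_mul_top_of_pos (by norm_num)

lemma half_mul_bot : ((1 / 2 : ℝ) : EReal) * ⊥ = ⊥ :=
  EReal.coe_mul_bot_of_pos (by norm_num)

lemma half_mul_mono {a b : EReal} (h : a ≤ b) :
    ((1 / 2 : ℝ) : EReal) * a ≤ ((1 / 2 : ℝ) : EReal) * b :=
  mul_le_mul_of_nonneg_left h (EReal.coe_nonneg.2 (by norm_num))

lemma le_of_forall_coe_le {a b : EReal} (h : ∀ c : ℝ, b ≤ c → a ≤ c) : a ≤ b :=
  EReal.le_of_forall_lt_iff_le.1 fun z hz => h z hz.le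

lemma symmetral_apply (u : E n) (ψ : E n → EReal) (x : E n) :
    symmetral u ψ x = ⨅ y : E n, ((1 / 2 : ℝ) : EReal) * ψ ((2 : ℝ) • y) +
      ((1 / 2 : ℝ) : EReal) * ψ (reflect u ((2 : ℝ) • (x - y))) := by
  simp [symmetral, infConv, epiMul, reflectFun]

lemma symmetral_le {u : E n} (hu : ‖u‖ = 1) {ψ : E n → EReal} {a b : E n} {p q : ℝ}
    (ha : ψ a ≤ p) (hb : ψ b ≤ q) :
    symmetral u ψ ((1 / 2 : ℝ) • (a + reflect u b)) ≤ (((p + q) / 2 : ℝ) : EReal) := by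
  rw [symmetral_apply]
  refine (iInf_le _ ((1 / 2 : ℝ) • a)).trans ?_
  have h1 : (2 : ℝ) • ((1 / 2 : ℝ) • a) = a := by rw [smul_smul]; norm_num
  have h2 : (2 : ℝ) • ((1 / 2 : ℝ) • (a + reflect u b) - (1 / 2 : ℝ) • a) = reflect u b := by
    rw [← smul_sub, smul_smul]; norm_num
  rw [h1, h2, reflect_reflect hu]
  calc _ ≤ ((1 / 2 : ℝ) : EReal) * (p : EReal) + ((1 / 2 : ℝ) : EReal) * (q : EReal) :=
        add_le_add (half_mul_mono ha) (half_mul_mono hb)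
    _ = _ := by
        rw [half_mul_coe, half_mul_coe, ← EReal.coe_add]
        congr 1
        ring

/-- The infimum need not be attained, so only strict bounds yield a decomposition; a summand +∞ is
excluded since the other summand is never -∞. -/
lemma exists_of_symmetral_lt {u : E n} (hu : ‖u‖ = 1) {ψ : E n → EReal} (hψ : ∀ x, ψ x ≠ ⊥)
    {x : E n} {t : EReal} (h : symmetral u ψ x < t) :
    ∃ (a b : E n) (p q : ℝ), ψ a = p ∧ ψ b = q ∧ x = (1 / 2 : ℝ) • (a + reflect u b) ∧
      (((p + q) / 2 : ℝ) : EReal) < t := by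
  rw [symmetral_apply, iInf_lt_iff] at h
  obtain ⟨y, hy⟩ := h
  set a := (2 : ℝ) • y with ha
  set b := reflect u ((2 : ℝ) • (x - y)) with hb
  have hat : ψ a ≠ ⊤ := by
    intro h0
    rw [h0, half_mul_top, EReal.top_add_of_ne_bot] at hy
    · exact not_top_lt hy
    · rcases eq_or_ne (ψ b) ⊤ with h | h
      · rw [h, half_mul_top]; exact top_ne_bot
      · obtain ⟨q, hq⟩ := exists_coe_of_ne (hψ b) h
        rw [hq, half_mul_coe]; exact EReal.coe_ne_bot _
  obtain ⟨p, hp⟩ := exists_coe_of_ne (hψ a) hat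
  have hbt : ψ b ≠ ⊤ := by
    intro h0
    rw [h0, half_mul_top, hp, half_mul_coe, EReal.coe_add_top] at hy
    exact not_top_lt hy
  obtain ⟨q, hq⟩ := exists_coe_of_ne (hψ b) hbt
  refine ⟨a, b, p, q, hp, hq, ?_, ?_⟩
  · rw [hb, reflect_reflect hu, ha, ← smul_add, add_sub_cancel, smul_smul]; norm_num
  · rw [hp, hq, half_mul_coe, half_mul_coe, ← EReal.coe_add] at hy
    convert hy using 2
    ring

/-- Convex functions which are bounded below and not identically `+∞`. -/
structure IsBddConvex (ψ : E n → EReal) : Prop where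
  convex : Convex ℝ {p : E n × ℝ | ψ p.1 ≤ (p.2 : EReal)}
  bddBelow : ∃ c : ℝ, ∀ x, (c : EReal) ≤ ψ x
  dom_nonempty : ∃ x, ψ x ≠ ⊤

lemma IsBddConvex.ne_bot {ψ : E n → EReal} (h : IsBddConvex ψ) (x : E n) : ψ x ≠ ⊥ := by
  obtain ⟨c, hc⟩ := h.bddBelow
  exact ((EReal.bot_lt_coe c).trans_le (hc x)).ne'

lemma convex_epigraph_le {ψ : E n → EReal} (h : Convex ℝ {p : E n × ℝ | ψ p.1 ≤ (p.2 : EReal)})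
    {a b : E n} {p q s t : ℝ} (ha : ψ a ≤ p) (hb : ψ b ≤ q) (hs : 0 ≤ s) (ht : 0 ≤ t)
    (hst : s + t = 1) : ψ (s • a + t • b) ≤ ((s * p + t * q : ℝ) : EReal) := by
  have h1 : (a, p) ∈ {p : E n × ℝ | ψ p.1 ≤ (p.2 : EReal)} := ha
  have h2 : (b, q) ∈ {p : E n × ℝ | ψ p.1 ≤ (p.2 : EReal)} := hb
  simpa using h h1 h2 hs ht hst

/-- Raising p and q by ε raises the right side by exactly ε because s + t = 1. Strict hypotheses are
what functions defined by infima can use. -/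
lemma convex_epigraph_of {ψ : E n → EReal}
    (h : ∀ (a b : E n) (p q s t : ℝ), ψ a < p → ψ b < q → 0 ≤ s → 0 ≤ t → s + t = 1 →
      ψ (s • a + t • b) ≤ ((s * p + t * q : ℝ) : EReal)) :
    Convex ℝ {p : E n × ℝ | ψ p.1 ≤ (p.2 : EReal)} := by
  rintro ⟨a, p⟩ ha ⟨b, q⟩ hb s t hs ht hst
  simp only [Set.mem_ofPred_eq] at ha hb
  change ψ (s • a + t • b) ≤ ((s * p + t * q : ℝ) : EReal)
  refine EReal.le_of_forall_lt_iff_le.1 fun z hz => ?_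
  have hz' : s * p + t * q < z := EReal.coe_lt_coe_iff.1 hz
  set ε := z - (s * p + t * q) with hε
  have h1 : ψ a < ((p + ε : ℝ) : EReal) := ha.trans_lt (EReal.coe_lt_coe_iff.2 (by linarith))
  have h2 : ψ b < ((q + ε : ℝ) : EReal) := hb.trans_lt (EReal.coe_lt_coe_iff.2 (by linarith))
  refine (h a b _ _ s t h1 h2 hs ht hst).trans (EReal.coe_le_coe_iff.2 ?_)
  have : s * ε + t * ε = ε := by rw [← add_mul, hst, one_mul]
  linarith

lemma le_symmetral {u : E n} (hu : ‖u‖ = 1) {ψ : E n → EReal} {c : ℝ}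
    (hc : ∀ x, (c : EReal) ≤ ψ x) (x : E n) : (c : EReal) ≤ symmetral u ψ x := by
  by_contra! h
  have hb : ∀ x, ψ x ≠ ⊥ := fun x => ((EReal.bot_lt_coe c).trans_le (hc x)).ne'
  obtain ⟨a, b, p, q, ha, hb, -, hlt⟩ := exists_of_symmetral_lt hu hb h
  have h1 := hc a
  have h2 := hc b
  rw [ha, EReal.coe_le_coe_iff] at h1
  rw [hb, EReal.coe_le_coe_iff] at h2
  rw [EReal.coe_lt_coe_iff] at hlt
  linarith

lemma convex_symmetral {u : E n} (hu : ‖u‖ = 1) {ψ : E n → EReal} (hb : ∀ x, ψ x ≠ ⊥)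
    (h : Convex ℝ {p : E n × ℝ | ψ p.1 ≤ (p.2 : EReal)}) :
    Convex ℝ {p : E n × ℝ | symmetral u ψ p.1 ≤ (p.2 : EReal)} := by
  refine convex_epigraph_of fun a b p q s t ha hb' hs ht hst => ?_
  obtain ⟨a₁, a₂, p₁, p₂, ha₁, ha₂, rfl, hp⟩ := exists_of_symmetral_lt hu hb ha
  obtain ⟨b₁, b₂, q₁, q₂, hb₁, hb₂, rfl, hq⟩ := exists_of_symmetral_lt hu hb hb'
  have e₁ := convex_epigraph_le h ha₁.le hb₁.le hs ht hst
  have e₂ := convex_epigraph_le h ha₂.le hb₂.le hs ht hst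
  have := symmetral_le hu e₁ e₂
  rw [reflect_add, reflect_smul, reflect_smul] at this
  have hx : (1 / 2 : ℝ) • (s • a₁ + t • b₁ + (s • reflect u a₂ + t • reflect u b₂)) =
      s • (1 / 2 : ℝ) • (a₁ + reflect u a₂) + t • (1 / 2 : ℝ) • (b₁ + reflect u b₂) := by
    module
  rw [hx] at this
  refine this.trans (EReal.coe_le_coe_iff.2 ?_)
  rw [EReal.coe_lt_coe_iff] at hp hq
  have h1 := mul_le_mul_of_nonneg_left hp.le hs
  have h2 := mul_le_mul_of_nonneg_left hq.le ht
  linarith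

lemma IsBddConvex.symmetral {u : E n} (hu : ‖u‖ = 1) {ψ : E n → EReal} (h : IsBddConvex ψ) :
    IsBddConvex (symmetral u ψ) where
  convex := convex_symmetral hu h.ne_bot h.convex
  bddBelow := by
    obtain ⟨c, hc⟩ := h.bddBelow
    exact ⟨c, le_symmetral hu hc⟩
  dom_nonempty := by
    obtain ⟨x, hx⟩ := h.dom_nonempty
    obtain ⟨p, hp⟩ := exists_coe_of_ne (h.ne_bot x) hx
    exact ⟨_, ((symmetral_le hu hp.le hp.le).trans_lt (EReal.coe_lt_top _)).ne⟩

lemma IsBddConvex.iterSymmetral {u : ℕ → E n} (hu : ∀ i, ‖u i‖ = 1) {ψ : E n → EReal}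
    (h : IsBddConvex ψ) (m : ℕ) : IsBddConvex (iterSymmetral u ψ m) := by
  induction m with
  | zero => exact h
  | succ m ih => exact ih.symmetral (hu m)

lemma le_iterSymmetral {u : ℕ → E n} (hu : ∀ i, ‖u i‖ = 1) {ψ : E n → EReal} {c : ℝ}
    (hc : ∀ x, (c : EReal) ≤ ψ x) (m : ℕ) (x : E n) : (c : EReal) ≤ iterSymmetral u ψ m x := by
  induction m generalizing x with
  | zero => exact hc x
  | succ m ih => exact le_symmetral (hu m) ih x

/-- A coercive lower semicontinuous function attains its minimum. -/
lemma IsConvC.exists_min {ψ : E n → EReal} (h : IsConvC ψ) : ∃ x₀, ∀ x, ψ x₀ ≤ ψ x := by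
  obtain ⟨x₁, hx₁⟩ := h.dom_nonempty
  have hev : ∀ᶠ x in cocompact (E n), ψ x₁ < ψ x :=
    h.coercive.eventually (lt_mem_nhds (lt_top_iff_ne_top.2 hx₁))
  obtain ⟨K, hK, hKs⟩ := mem_cocompact.1 hev
  have hmem : ∀ x, ψ x ≤ ψ x₁ → x ∈ K := fun x hx => by
    by_contra hxK
    exact absurd (hKs hxK) (not_lt.2 hx)
  obtain ⟨x₀, -, hmin⟩ := LowerSemicontinuousOn.exists_isMinOn ⟨x₁, hmem x₁ le_rfl⟩ hK
    (h.lsc.lowerSemicontinuousOn K)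
  refine ⟨x₀, fun x => ?_⟩
  by_cases hx : ψ x ≤ ψ x₁
  · exact hmin (hmem x hx)
  · exact (hmin (hmem x₁ le_rfl)).trans (not_le.1 hx).le

lemma IsConvC.isBddConvex {ψ : E n → EReal} (h : IsConvC ψ) : IsBddConvex ψ where
  convex := h.convex
  bddBelow := by
    obtain ⟨x₀, hx₀⟩ := h.exists_min
    obtain ⟨x₁, hx₁⟩ := h.dom_nonempty
    obtain ⟨c, hc⟩ := exists_coe_of_ne (h.ne_bot x₀)
      ((hx₀ x₁).trans_lt (lt_top_iff_ne_top.2 hx₁)).ne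
    exact ⟨c, fun x => hc ▸ hx₀ x⟩
  dom_nonempty := h.dom_nonempty

/-- A coercive convex function grows at least linearly. -/
lemma IsConvC.exists_linear_growth {ψ : E n → EReal} (h : IsConvC ψ) :
    ∃ ρ C : ℝ, 0 < ρ ∧ ∀ x, ((ρ * ‖x‖ - C : ℝ) : EReal) ≤ ψ x := by
  obtain ⟨c, hc⟩ := h.isBddConvex.bddBelow
  obtain ⟨x₀, hx₀⟩ := h.dom_nonempty
  obtain ⟨a, ha⟩ := exists_coe_of_ne (h.ne_bot x₀) hx₀
  have hev : ∀ᶠ x in cocompact (E n), ((a + 1 : ℝ) : EReal) < ψ x :=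
    h.coercive.eventually (lt_mem_nhds (EReal.coe_lt_top _))
  obtain ⟨K, hK, hKs⟩ := mem_cocompact.1 hev
  obtain ⟨R, hR0, hR⟩ := hK.isBounded.subset_closedBall_lt 0 x₀
  have hbig : ∀ x, 2 * R ≤ ‖x - x₀‖ → ((a + ‖x - x₀‖ / (2 * R) : ℝ) : EReal) ≤ ψ x := by
    intro x hx
    by_contra! hlt
    obtain ⟨p, hp⟩ := exists_coe_of_ne (h.ne_bot x) (hlt.trans (EReal.coe_lt_top _)).ne
    rw [hp, EReal.coe_lt_coe_iff] at hlt
    have hd : 0 < ‖x - x₀‖ := by linarith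
    -- This t moves x along its segment to distance 2R from x₀, hence out of K, where ψ exceeds a +
    -- 1; convexity then forces slope at least 1/(2R) from x₀ to x.
    set t := 2 * R / ‖x - x₀‖ with ht
    have ht0 : 0 < t := by positivity
    have ht1 : t ≤ 1 := (div_le_one hd).2 hx
    have hle := convex_epigraph_le h.convex ha.le hp.le (sub_nonneg.2 ht1) ht0.le (by ring)
    have hout : (1 - t) • x₀ + t • x ∉ K := by
      intro hmem
      have := hR hmem
      rw [Metric.mem_closedBall, dist_eq_norm,
        show (1 - t) • x₀ + t • x - x₀ = t • (x - x₀) by module, norm_smul, Real.norm_of_nonneg ht0.le,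
        ht, div_mul_cancel₀ _ hd.ne'] at this
      linarith
    have h2 := (hKs hout : ((a + 1 : ℝ) : EReal) < _).trans_le hle
    rw [EReal.coe_lt_coe_iff] at h2
    have h3 : t * (p - a) < 1 := by
      calc t * (p - a) < t * (‖x - x₀‖ / (2 * R)) := by
            apply mul_lt_mul_of_pos_left _ ht0; linarith
        _ = 1 := by rw [ht]; field_simp
    linarith
  refine ⟨1 / (2 * R), |a| + |c| + 1 + ‖x₀‖ / (2 * R), by positivity, fun x => ?_⟩
  have hn : ‖x‖ / (2 * R) ≤ ‖x - x₀‖ / (2 * R) + ‖x₀‖ / (2 * R) := by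
    rw [← add_div]
    have := norm_add_le (x - x₀) x₀
    rw [sub_add_cancel] at this
    gcongr
  have e : 1 / (2 * R) * ‖x‖ = ‖x‖ / (2 * R) := by ring
  by_cases hx : 2 * R ≤ ‖x - x₀‖
  · refine le_trans (EReal.coe_le_coe_iff.2 ?_) (hbig x hx)
    have := neg_abs_le a
    have := abs_nonneg c
    linarith
  · refine le_trans (EReal.coe_le_coe_iff.2 ?_) (hc x)
    have : ‖x - x₀‖ / (2 * R) ≤ 1 := (div_le_one (by positivity)).2 (not_le.1 hx).le
    have := neg_abs_le c
    have := abs_nonneg a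
    linarith

end Symmetral

/-! ### Legendre conjugates -/

section Conjugate

variable {n : ℕ}

/-- The Legendre conjugate of a convex function. -/
noncomputable def conj (ψ : E n → EReal) (y : E n) : EReal :=
  ⨆ x : E n, ((inner ℝ x y : ℝ) : EReal) - ψ x

lemma conj_le_iff {ψ : E n → EReal} {y : E n} {c : ℝ} :
    conj ψ y ≤ (c : EReal) ↔ ∀ x, ((inner ℝ x y - c : ℝ) : EReal) ≤ ψ x := by
  rw [conj, iSup_le_iff]
  refine forall_congr' fun x => ?_
  generalize ψ x = a
  induction a with
  | bot => simp [-EReal.coe_sub]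
  | top => simp
  | coe a =>
    rw [← EReal.coe_sub, EReal.coe_le_coe_iff, EReal.coe_le_coe_iff]
    constructor <;> intro h <;> linarith

lemma IsBddConvex.conj_ne_bot {ψ : E n → EReal} (h : IsBddConvex ψ) (y : E n) :
    conj ψ y ≠ ⊥ := by
  obtain ⟨x, hx⟩ := h.dom_nonempty
  obtain ⟨p, hp⟩ := exists_coe_of_ne (h.ne_bot x) hx
  have : ((inner ℝ x y - p : ℝ) : EReal) ≤ conj ψ y := by
    rw [EReal.coe_sub, ← hp]
    exact le_iSup (fun x : E n => ((inner ℝ x y : ℝ) : EReal) - ψ x) x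
  exact ((EReal.bot_lt_coe _).trans_le this).ne'

lemma le_of_conj_le {ψ : E n → EReal} {y : E n} {c : ℝ} (h : conj ψ y ≤ (c : EReal)) (x : E n) :
    ((inner ℝ x y - c : ℝ) : EReal) ≤ ψ x :=
  conj_le_iff.1 h x

lemma conj_convex {ψ : E n → EReal} {y z : E n} {p q s t : ℝ} (hy : conj ψ y ≤ p)
    (hz : conj ψ z ≤ q) (hs : 0 ≤ s) (ht : 0 ≤ t) (hst : s + t = 1) :
    conj ψ (s • y + t • z) ≤ ((s * p + t * q : ℝ) : EReal) := by
  rw [conj_le_iff] at *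
  intro x
  rcases le_total (inner ℝ x y - p) (inner ℝ x z - q) with h | h
  · refine le_trans (EReal.coe_le_coe_iff.2 ?_) (hz x)
    rw [inner_add_right, real_inner_smul_right, real_inner_smul_right]
    have := mul_le_mul_of_nonneg_left h hs
    have e : t = 1 - s := by linarith
    subst e
    linarith
  · refine le_trans (EReal.coe_le_coe_iff.2 ?_) (hy x)
    rw [inner_add_right, real_inner_smul_right, real_inner_smul_right]
    have := mul_le_mul_of_nonneg_left h ht
    have e : s = 1 - t := by linarith
    subst e
    linarith

/-- The average `½ h + ½ h ∘ R_u` of a function with its reflection. -/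
noncomputable def average (u : E n) (h : E n → EReal) (y : E n) : EReal :=
  ((1 / 2 : ℝ) : EReal) * h y + ((1 / 2 : ℝ) : EReal) * h (reflect u y)

lemma average_coe {u : E n} {h : E n → EReal} {y : E n} {p q : ℝ} (hp : h y = p)
    (hq : h (reflect u y) = q) : average u h y = (((p + q) / 2 : ℝ) : EReal) := by
  rw [average, hp, hq, half_mul_coe, half_mul_coe, ← EReal.coe_add]
  congr 1
  ring

lemma half_mul_ne_bot {a : EReal} (h : a ≠ ⊥) : ((1 / 2 : ℝ) : EReal) * a ≠ ⊥ := by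
  induction a with
  | bot => exact absurd rfl h
  | top => rw [half_mul_top]; exact top_ne_bot
  | coe a => rw [half_mul_coe]; exact EReal.coe_ne_bot _

lemma average_eq_top {u : E n} {h : E n → EReal} (hb : ∀ y, h y ≠ ⊥) {y : E n}
    (hy : h y = ⊤ ∨ h (reflect u y) = ⊤) : average u h y = ⊤ := by
  rw [average]
  rcases hy with hy | hy
  · rw [hy, half_mul_top, EReal.top_add_of_ne_bot (half_mul_ne_bot (hb _))]
  · rw [hy, half_mul_top, EReal.add_top_of_ne_bot (half_mul_ne_bot (hb _))]

/-- Conjugation turns infimal convolution into addition, the factor 1/2 into the factor 1/2, and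
commutes with R_u because R_u is self-adjoint and involutive. -/
lemma conj_symmetral {u : E n} (hu : ‖u‖ = 1) {ψ : E n → EReal} (h : IsBddConvex ψ) :
    conj (symmetral u ψ) = average u (conj ψ) := by
  funext y
  apply le_antisymm
  · by_cases h1 : conj ψ y = ⊤
    · rw [average_eq_top h.conj_ne_bot (Or.inl h1)]; exact le_top
    by_cases h2 : conj ψ (reflect u y) = ⊤
    · rw [average_eq_top h.conj_ne_bot (Or.inr h2)]; exact le_top
    obtain ⟨p, hp⟩ := exists_coe_of_ne (h.conj_ne_bot _) h1
    obtain ⟨q, hq⟩ := exists_coe_of_ne (h.conj_ne_bot _) h2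
    rw [average_coe hp hq, conj_le_iff]
    intro x
    by_contra! hlt
    obtain ⟨a, b, r, s, ha, hb, rfl, hrs⟩ := exists_of_symmetral_lt hu h.ne_bot hlt
    have e1 := le_of_conj_le hp.le a
    have e2 := le_of_conj_le hq.le b
    rw [ha, EReal.coe_le_coe_iff] at e1
    rw [hb, EReal.coe_le_coe_iff] at e2
    rw [EReal.coe_lt_coe_iff, real_inner_smul_left, inner_add_left, inner_reflect_left] at hrs
    linarith
  · refine le_of_forall_coe_le fun c hc => ?_
    have key : ∀ (a b : E n) (r s : ℝ), ψ a = r → ψ b = s →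
        inner ℝ a y - r + (inner ℝ b (reflect u y) - s) ≤ 2 * c := by
      intro a b r s ha hb
      have := (le_of_conj_le hc _).trans (symmetral_le hu ha.le hb.le)
      rw [EReal.coe_le_coe_iff, real_inner_smul_left, inner_add_left, inner_reflect_left] at this
      linarith
    have hfin : ∀ (z : E n) (c : ℝ), (∀ (a : E n) (r : ℝ), ψ a = r → inner ℝ a z - r ≤ c) →
        conj ψ z ≤ c := by
      intro z c hz
      rw [conj_le_iff]
      intro x
      rcases eq_or_ne (ψ x) ⊤ with hx | hx
      · rw [hx]; exact le_top
      obtain ⟨r, hr⟩ := exists_coe_of_ne (h.ne_bot x) hx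
      rw [hr, EReal.coe_le_coe_iff]
      linarith [hz x r hr]
    -- The two suprema are separated one at a time: a fixed second point shows that the first
    -- supremum is finite, and only then can the second be bounded in terms of it.
    obtain ⟨x₀, hx₀⟩ := h.dom_nonempty
    obtain ⟨r₀, hr₀⟩ := exists_coe_of_ne (h.ne_bot x₀) hx₀
    have h1 : conj ψ y ≤ ((2 * c - (inner ℝ x₀ (reflect u y) - r₀) : ℝ) : EReal) :=
      hfin _ _ fun a r ha => by linarith [key a x₀ r r₀ ha hr₀]
    obtain ⟨p, hp⟩ := exists_coe_of_ne (h.conj_ne_bot y) (h1.trans_lt (EReal.coe_lt_top _)).ne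
    have h2 : conj ψ (reflect u y) ≤ ((2 * c - p : ℝ) : EReal) := by
      refine hfin _ _ fun b s hb => ?_
      have : conj ψ y ≤ ((2 * c - (inner ℝ b (reflect u y) - s) : ℝ) : EReal) :=
        hfin _ _ fun a r ha => by linarith [key a b r s ha hb]
      rw [hp, EReal.coe_le_coe_iff] at this
      linarith
    obtain ⟨q, hq⟩ := exists_coe_of_ne (h.conj_ne_bot (reflect u y))
      (h2.trans_lt (EReal.coe_lt_top _)).ne
    rw [hq, EReal.coe_le_coe_iff] at h2
    rw [average_coe hp hq, EReal.coe_le_coe_iff]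
    linarith

/-- If `t` bounds the `s`-Lipschitz envelope of `ψ` at `x` from below, then some slope of norm at
most `s` certifies it. -/
lemma exists_conj_le {ψ : E n → EReal} (h : IsBddConvex ψ) {x : E n} {s t : ℝ} (hs : 0 ≤ s)
    (hst : ∀ z, ((t - s * ‖z - x‖ : ℝ) : EReal) ≤ ψ z) :
    ∃ y : E n, ‖y‖ ≤ s ∧ conj ψ y ≤ ((inner ℝ x y - t : ℝ) : EReal) := by
  -- The open region below the cone t - s‖· - x‖ is convex and misses the epigraph; a separating
  -- hyperplane gives the slope.
  set B : Set (E n × ℝ) := {p | p.2 + s * ‖p.1 - x‖ < t} with hB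
  have hBo : IsOpen B := isOpen_lt (by fun_prop) continuous_const
  have hBc : Convex ℝ B := by
    rintro ⟨a, p⟩ ha ⟨b, q⟩ hb α β hα hβ hαβ
    simp only [hB, Set.mem_ofPred_eq] at ha hb
    change α * p + β * q + s * ‖α • a + β • b - x‖ < t
    have e : α • a + β • b - x = α • (a - x) + β • (b - x) := by
      have : x = (α + β) • x := by rw [hαβ, one_smul]
      nth_rewrite 1 [this]
      module
    have h1 : ‖α • a + β • b - x‖ ≤ α * ‖a - x‖ + β * ‖b - x‖ := by
      rw [e]
      refine (norm_add_le _ _).trans ?_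
      rw [norm_smul, norm_smul, Real.norm_of_nonneg hα, Real.norm_of_nonneg hβ]
    have h2 := mul_le_mul_of_nonneg_left h1 hs
    rcases hα.eq_or_lt with h0 | h0
    · subst h0
      have : β = 1 := by linarith
      subst this
      linarith
    · have h3 := mul_lt_mul_of_pos_left ha h0
      have h4 := mul_le_mul_of_nonneg_left hb.le hβ
      have : α * t + β * t = t := by rw [← add_mul, hαβ, one_mul]
      linarith
  have hdisj : Disjoint B {p : E n × ℝ | ψ p.1 ≤ (p.2 : EReal)} := by
    rw [Set.disjoint_left]
    rintro ⟨z, τ⟩ h1 h2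
    simp only [hB, Set.mem_ofPred_eq] at h1 h2
    have := (hst z).trans h2
    rw [EReal.coe_le_coe_iff] at this
    linarith
  obtain ⟨f, v, hf1, hf2⟩ := geometric_hahn_banach_open hBc hBo h.convex hdisj
  set w : E n := (InnerProductSpace.toDual ℝ (E n)).symm (f.comp (ContinuousLinearMap.inl ℝ (E n) ℝ))
    with hw
  set β : ℝ := f (0, 1) with hβ
  have hf : ∀ z τ, f (z, τ) = inner ℝ w z + β * τ := by
    intro z τ
    have e : (z, τ) = (z, (0 : ℝ)) + τ • ((0 : E n), (1 : ℝ)) := by simp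
    rw [e, map_add, map_smul, hw, InnerProductSpace.toDual_symm_apply, smul_eq_mul, mul_comm τ]
    rfl
  obtain ⟨x₁, hx₁⟩ := h.dom_nonempty
  obtain ⟨r₁, hr₁⟩ := exists_coe_of_ne (h.ne_bot x₁) hx₁
  have h1 : v ≤ inner ℝ w x₁ + β * r₁ := hf x₁ r₁ ▸ hf2 (x₁, r₁) hr₁.le
  have hlow : ∀ z τ, τ + s * ‖z - x‖ < t → inner ℝ w z + β * τ < v :=
    fun z τ hz => hf z τ ▸ hf1 (z, τ) hz
  -- The hyperplane is not vertical: the region below the cone has points directly under the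
  -- epigraph point (x₁, r₁).
  have hβ0 : 0 < β := by
    set τ := min (r₁ - 1) (t - s * ‖x₁ - x‖ - 1) with hτ
    have h2 := hlow x₁ τ (by have := min_le_right (r₁ - 1) (t - s * ‖x₁ - x‖ - 1); linarith)
    have h3 : τ < r₁ := by have := min_le_left (r₁ - 1) (t - s * ‖x₁ - x‖ - 1); linarith
    have h4 : 0 < β * (r₁ - τ) := by rw [mul_sub]; linarith
    exact pos_of_mul_pos_left h4 (by linarith)
  have hlow' : ∀ z, inner ℝ w z + β * (t - s * ‖z - x‖) ≤ v := by
    intro z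
    refine le_of_forall_pos_lt_add fun ε hε => ?_
    have := hlow z (t - s * ‖z - x‖ - ε / β) (by have := div_pos hε hβ0; linarith)
    have e : β * (ε / β) = ε := by field_simp
    nlinarith [this, e]
  set y : E n := (-β⁻¹) • w with hy
  have hwy : w = (-β) • y := by
    rw [hy, smul_smul]
    simp [hβ0.ne']
  have hin : ∀ z, inner ℝ w z = -β * inner ℝ z y := by
    intro z
    rw [hwy, real_inner_smul_left, real_inner_comm]
  refine ⟨y, ?_, ?_⟩
  · by_contra! hlt
    have hy0 : 0 < ‖y‖ := hs.trans_lt hlt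
    -- A slope steeper than the cone would win at rate g along the ray from x in direction -y, and
    -- so cross the hyperplane for k large.
    set g := ‖y‖ * (‖y‖ - s) with hg
    have hg0 : 0 < g := mul_pos hy0 (by linarith)
    set k := (|v / β - (t - inner ℝ x y)| + 1) / g with hk
    have hk0 : 0 < k := by positivity
    have := hlow' (x - k • y)
    rw [hin, inner_sub_left, real_inner_smul_left, real_inner_self_eq_norm_sq, sub_sub_cancel_left,
      norm_neg, norm_smul k y, Real.norm_of_nonneg hk0.le] at this
    have h5 : t - inner ℝ x y + k * g ≤ v / β := by
      rw [le_div_iff₀ hβ0, hg]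
      linarith
    have h6 : k * g = |v / β - (t - inner ℝ x y)| + 1 := by rw [hk]; field_simp
    have := le_abs_self (v / β - (t - inner ℝ x y))
    linarith
  · rw [conj_le_iff]
    intro z
    rcases eq_or_ne (ψ z) ⊤ with hz | hz
    · rw [hz]; exact le_top
    obtain ⟨r, hr⟩ := exists_coe_of_ne (h.ne_bot z) hz
    rw [hr, EReal.coe_le_coe_iff]
    have h2 : v ≤ inner ℝ w z + β * r := hf z r ▸ hf2 (z, r) hr.le
    have h3 := hlow' x
    rw [sub_self, norm_zero, mul_zero, sub_zero] at h3
    rw [hin] at h2 h3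
    have : β * (inner ℝ z y - (inner ℝ x y - t)) ≤ β * r := by linarith
    exact le_of_mul_le_mul_left this hβ0

end Conjugate

/-! ### Averaging over reflections flattens functions on spheres -/

section Averaging

variable {n : ℕ}

/-- The unit vectors of `ℝⁿ`. -/
abbrev UnitVec (n : ℕ) : Type := {u : E n // ‖u‖ = 1}

/-- Successive averages along a list of unit vectors. -/
noncomputable def averageList (L : List (UnitVec n)) (h : E n → EReal) : E n → EReal :=
  L.foldl (fun h u => average u.1 h) h

/-- Successive averages of a real-valued function along a list of unit vectors. -/
noncomputable def realAverageList (L : List (UnitVec n)) (H : E n → ℝ) : E n → ℝ :=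
  L.foldl (fun H u y => (H y + H (reflect u.1 y)) / 2) H

/-- The points carried into `A` by the composition of a sublist of the reflections in `L`. -/
def spread (L : List (UnitVec n)) (A : Set (E n)) : Set (E n) :=
  L.foldl (fun A u => A ∪ reflect u.1 ⁻¹' A) A

lemma averageList_append (L L' : List (UnitVec n)) (h : E n → EReal) :
    averageList (L ++ L') h = averageList L' (averageList L h) := by
  simp [averageList]

lemma realAverageList_append (L L' : List (UnitVec n)) (H : E n → ℝ) :
    realAverageList (L ++ L') H = realAverageList L' (realAverageList L H) := by
  simp [realAverageList]

lemma averageList_cons (u : UnitVec n) (L : List (UnitVec n)) (h : E n → EReal) :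
    averageList (u :: L) h = averageList L (average u.1 h) := rfl

lemma realAverageList_cons (u : UnitVec n) (L : List (UnitVec n)) (H : E n → ℝ) :
    realAverageList (u :: L) H = realAverageList L (fun y => (H y + H (reflect u.1 y)) / 2) := rfl

lemma averageList_coe {L : List (UnitVec n)} {h : E n → EReal} {H : E n → ℝ} {q : ℝ}
    (hH : ∀ y, ‖y‖ ≤ q → h y = H y) (y : E n) (hy : ‖y‖ ≤ q) :
    averageList L h y = realAverageList L H y := by
  induction L generalizing h H with
  | nil => exact hH y hy
  | cons u L ih =>
    rw [averageList_cons, realAverageList_cons]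
    exact ih fun z hz => average_coe (hH z hz) (hH _ (by rwa [norm_reflect u.2]))

lemma realAverageList_lipschitz {L : List (UnitVec n)} {H : E n → ℝ} {q K : ℝ}
    (hH : ∀ y z, ‖y‖ ≤ q → ‖z‖ ≤ q → |H y - H z| ≤ K * ‖y - z‖) (y z : E n) (hy : ‖y‖ ≤ q)
    (hz : ‖z‖ ≤ q) : |realAverageList L H y - realAverageList L H z| ≤ K * ‖y - z‖ := by
  induction L generalizing H with
  | nil => exact hH y z hy hz
  | cons u L ih =>
    rw [realAverageList_cons]
    refine ih fun y z hy hz => ?_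
    have h1 := hH y z hy hz
    have h2 := hH (reflect u.1 y) (reflect u.1 z) (by rwa [norm_reflect u.2])
      (by rwa [norm_reflect u.2])
    rw [← reflect_sub, norm_reflect u.2] at h2
    rw [abs_le] at *
    constructor <;> linarith [h1.1, h1.2, h2.1, h2.2]

/-- `H` oscillates by at most `ε` on the sphere of radius `ρ`. -/
def OscLe (H : E n → ℝ) (ρ ε : ℝ) : Prop := ∀ y z : E n, ‖y‖ = ρ → ‖z‖ = ρ → H y ≤ H z + ε

lemma OscLe.realAverageList {H : E n → ℝ} {ρ ε : ℝ} (h : OscLe H ρ ε) (L : List (UnitVec n)) :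
    OscLe (realAverageList L H) ρ ε := by
  induction L generalizing H with
  | nil => exact h
  | cons u L ih =>
    rw [realAverageList_cons]
    refine ih fun y z hy hz => ?_
    have h1 := h y z hy hz
    have h2 := h (reflect u.1 y) (reflect u.1 z) (by rwa [norm_reflect u.2])
      (by rwa [norm_reflect u.2])
    linarith

lemma le_realAverageList {L : List (UnitVec n)} {H : E n → ℝ} {ρ m : ℝ}
    (hH : ∀ y, ‖y‖ = ρ → m ≤ H y) (y : E n) (hy : ‖y‖ = ρ) : m ≤ realAverageList L H y := by
  induction L generalizing H with
  | nil => exact hH y hy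
  | cons u L ih =>
    rw [realAverageList_cons]
    refine ih fun y hy => ?_
    have h1 := hH y hy
    have h2 := hH (reflect u.1 y) (by rwa [norm_reflect u.2])
    linarith

/-- One averaging halves the deficit η below the upper bound M, but extends it to every point whose
reflection lies in A; the other term of the average is still at most M. -/
lemma realAverageList_le_of_spread {L : List (UnitVec n)} {H : E n → ℝ} {ρ M η : ℝ}
    {A : Set (E n)} (hη : 0 ≤ η) (hM : ∀ y, ‖y‖ = ρ → H y ≤ M)
    (hA : ∀ y ∈ A, ‖y‖ = ρ → H y ≤ M - η) (y : E n) (hy : y ∈ spread L A) (hyρ : ‖y‖ = ρ) :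
    realAverageList L H y ≤ M - η / 2 ^ L.length := by
  induction L generalizing H A η with
  | nil => simpa [realAverageList] using hA y hy hyρ
  | cons u L ih =>
    rw [realAverageList_cons]
    have := ih (H := fun y => (H y + H (reflect u.1 y)) / 2) (A := A ∪ reflect u.1 ⁻¹' A)
      (η := η / 2) (by positivity) ?_ ?_ hy
    · rwa [div_div, ← pow_succ'] at this
    · intro z hz
      have h1 := hM z hz
      have h2 := hM (reflect u.1 z) (by rwa [norm_reflect u.2])
      linarith
    · intro z hzA hz
      have hz' : ‖reflect u.1 z‖ = ρ := by rwa [norm_reflect u.2]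
      rcases hzA with hzA | hzA
      · have h1 := hA z hzA hz
        have h2 := hM _ hz'
        linarith
      · have h1 := hM z hz
        have h2 := hA _ hzA hz'
        linarith

lemma average_ne_bot {h : E n → EReal} (hb : ∀ y, h y ≠ ⊥) (u y : E n) : average u h y ≠ ⊥ := by
  have h1 := half_mul_ne_bot (hb y)
  have h2 := half_mul_ne_bot (hb (reflect u y))
  rw [average, Ne, EReal.add_eq_bot_iff]
  tauto

lemma averageList_ne_bot {L : List (UnitVec n)} {h : E n → EReal} (hb : ∀ y, h y ≠ ⊥) (y : E n) :
    averageList L h y ≠ ⊥ := by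
  induction L generalizing h with
  | nil => exact hb y
  | cons u L ih => exact ih (average_ne_bot hb u.1)

/-- The value +∞ spreads without any loss, since an average with one infinite term is infinite. -/
lemma averageList_eq_top_of_spread {L : List (UnitVec n)} {h : E n → EReal} (hb : ∀ y, h y ≠ ⊥)
    {A : Set (E n)} (hA : ∀ y ∈ A, h y = ⊤) (y : E n) (hy : y ∈ spread L A) :
    averageList L h y = ⊤ := by
  induction L generalizing h A with
  | nil => exact hA y hy
  | cons u L ih =>
    refine ih (average_ne_bot hb u.1) (A := A ∪ reflect u.1 ⁻¹' A) (fun z hz => ?_) hy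
    exact average_eq_top hb (hz.imp (hA z) (hA _))

lemma subset_spread (L : List (UnitVec n)) (A : Set (E n)) : A ⊆ spread L A := by
  induction L generalizing A with
  | nil => exact subset_rfl
  | cons u L ih => exact Set.subset_union_left.trans (ih _)

lemma spread_mono (L : List (UnitVec n)) {A B : Set (E n)} (h : A ⊆ B) :
    spread L A ⊆ spread L B := by
  induction L generalizing A B with
  | nil => exact h
  | cons u L ih => exact ih (Set.union_subset_union h (Set.preimage_mono h))

lemma preimage_subset_spread {L : List (UnitVec n)} {u : UnitVec n} (hu : u ∈ L) (A : Set (E n)) :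
    reflect u.1 ⁻¹' A ⊆ spread L A := by
  induction L generalizing A with
  | nil => simp at hu
  | cons v L ih =>
    rcases List.mem_cons.1 hu with rfl | h
    · exact Set.subset_union_right.trans (subset_spread L _)
    · exact (ih h A).trans (spread_mono L Set.subset_union_left)

lemma averageList_eq_top {L : List (UnitVec n)} {h : E n → EReal} (hb : ∀ y, h y ≠ ⊥) {y : E n}
    (hy : h y = ⊤) : averageList L h y = ⊤ :=
  averageList_eq_top_of_spread hb (A := {y}) (by rintro _ rfl; exact hy) y
    (subset_spread L _ rfl)

/-- Boundedly many reflections spread any cap of a given size over the whole sphere. -/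
lemma exists_spread (hn : 0 < n) (ρ : ℝ) {δ : ℝ} (hδ : 0 < δ) :
    ∃ N : ℕ, ∀ p : E n, ‖p‖ = ρ → ∃ L : List (UnitVec n), L.length = N ∧
      ∀ y, ‖y‖ = ρ → y ∈ spread L (Metric.ball p δ) := by
  classical
  -- One cover of the sphere by δ-balls serves all p. Each centre q contributes one reflection with
  -- q ↦ p, carrying the ball at q to the ball at p; a dummy reflection for q = p keeps the length
  -- equal to the number of centres.
  obtain ⟨t, hts, htf, htc⟩ := (isCompact_sphere (0 : E n) ρ).finite_cover_balls hδ
  obtain ⟨v, hv⟩ := exists_norm_eq_one hn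
  refine ⟨htf.toFinset.toList.length, fun p hp => ?_⟩
  have hu : ∀ q : E n, ∃ u : UnitVec n, q ∈ t → q ≠ p → reflect u.1 q = p := by
    intro q
    by_cases hq : q ∈ t ∧ q ≠ p
    · have : ‖q‖ = ρ := by simpa using hts hq.1
      obtain ⟨u, h1, h2⟩ := exists_reflect_eq (hp.trans this.symm) hq.2
      exact ⟨⟨u, h1⟩, fun _ _ => h2⟩
    · exact ⟨⟨v, hv⟩, fun h1 h2 => absurd ⟨h1, h2⟩ hq⟩
  choose f hf using hu
  refine ⟨htf.toFinset.toList.map f, by simp, fun y hy => ?_⟩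
  have hmem := htc (show y ∈ Metric.sphere (0 : E n) ρ by simpa using hy)
  simp only [Set.mem_iUnion] at hmem
  obtain ⟨q, hqt, hyq⟩ := hmem
  by_cases hqp : q = p
  · exact subset_spread _ _ (hqp ▸ hyq)
  · refine preimage_subset_spread (u := f q) (List.mem_map.2 ⟨q, by simpa using hqt, rfl⟩) _ ?_
    rw [Set.mem_preimage, Metric.mem_ball, ← hf q hqt hqp, dist_reflect (f q).2]
    exact hyq

/-- Averaging makes a Lipschitz function nearly constant on a sphere. -/
lemma exists_oscLe_sphere (hn : 0 < n) {q K ρ ε : ℝ} (hρ : 0 ≤ ρ) (hρq : ρ ≤ q) (hK : 0 ≤ K)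
    (hε : 0 < ε) (H : E n → ℝ) (hH : ∀ y z, ‖y‖ ≤ q → ‖z‖ ≤ q → |H y - H z| ≤ K * ‖y - z‖) :
    ∃ L : List (UnitVec n), OscLe (realAverageList L H) ρ ε := by
  -- With Kδ ≤ ε/2, the δ-cap about a minimum point lies ε/2 below the maximum whenever the
  -- oscillation exceeds ε.
  set δ := ε / (2 * (K + 1)) with hδ
  have hδ0 : 0 < δ := by positivity
  have hKδ : K * δ ≤ ε / 2 := by
    rw [hδ, mul_div_assoc', div_le_div_iff₀ (by positivity) (by norm_num)]
    nlinarith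
  obtain ⟨N, hN⟩ := exists_spread hn ρ hδ0
  set c := ε / 2 / 2 ^ N with hc
  have hc0 : 0 < c := by positivity
  -- Each round of N reflections lowers the maximum by at least c and does not lower the minimum.
  -- The gain c is the same in every round because K persists and N does not depend on p.
  have key : ∀ (k : ℕ) (H : E n → ℝ),
      (∀ y z, ‖y‖ ≤ q → ‖z‖ ≤ q → |H y - H z| ≤ K * ‖y - z‖) → OscLe H ρ (ε + k * c) →
      ∃ L : List (UnitVec n), OscLe (realAverageList L H) ρ ε := by
    intro k
    induction k with
    | zero => intro H _ h; exact ⟨[], by simpa [realAverageList] using h⟩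
    | succ k ih =>
      intro H hH hosc
      have hcont : ContinuousOn H (Metric.sphere (0 : E n) ρ) := by
        have : LipschitzOnWith K.toNNReal H (Metric.sphere (0 : E n) ρ) := by
          refine LipschitzOnWith.of_dist_le_mul fun y hy z hz => ?_
          rw [Real.dist_eq, dist_eq_norm, Real.coe_toNNReal _ hK]
          refine hH y z ?_ ?_
          · rw [mem_sphere_zero_iff_norm.1 hy]; exact hρq
          · rw [mem_sphere_zero_iff_norm.1 hz]; exact hρq
        exact this.continuousOn
      have hne : (Metric.sphere (0 : E n) ρ).Nonempty := by
        obtain ⟨v, hv⟩ := exists_norm_eq_one hn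
        exact ⟨ρ • v, by simp [norm_smul, hv, abs_of_nonneg hρ]⟩
      obtain ⟨p, hp, hpmin⟩ := (isCompact_sphere (0 : E n) ρ).exists_isMinOn hne hcont
      obtain ⟨r, hr, hrmax⟩ := (isCompact_sphere (0 : E n) ρ).exists_isMaxOn hne hcont
      rw [mem_sphere_zero_iff_norm] at hp hr
      have hmin : ∀ y, ‖y‖ = ρ → H p ≤ H y := fun y hy => hpmin (by simpa using hy)
      have hmax : ∀ y, ‖y‖ = ρ → H y ≤ H r := fun y hy => hrmax (by simpa using hy)
      by_cases hsmall : H r ≤ H p + ε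
      · exact ⟨[], fun y z hy hz => by
          have := hmin z hz
          have := hmax y hy
          change H y ≤ H z + ε
          linarith⟩
      push Not at hsmall
      obtain ⟨L, hL, hLs⟩ := hN p hp
      have hle := realAverageList_le_of_spread (L := L) (A := Metric.ball p δ) (η := ε / 2)
        (by positivity) hmax (fun y hy hyρ => ?_)
      · obtain ⟨L', hL'⟩ := ih (realAverageList L H)
          (fun y z hy hz => realAverageList_lipschitz hH y z hy hz) (fun y z hy hz => by
            have h1 := hle y (hLs y hy) hy
            have h2 := le_realAverageList (L := L) hmin z hz
            have h3 := hosc r p hr hp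
            rw [hL, ← hc] at h1
            push_cast at h3
            linarith)
        exact ⟨L ++ L', by rwa [realAverageList_append]⟩
      · have h1 := le_of_abs_le (hH y p (hyρ.trans_le hρq) (hp.trans_le hρq))
        have h2 : K * ‖y - p‖ ≤ K * δ := by
          rw [Metric.mem_ball, dist_eq_norm] at hy
          exact mul_le_mul_of_nonneg_left hy.le hK
        linarith
  obtain ⟨k, hk⟩ := exists_nat_ge (K * (2 * ρ) / c)
  refine key k H hH fun y z hy hz => ?_
  have h1 := le_of_abs_le (hH y z (hy.trans_le hρq) (hz.trans_le hρq))
  have h2 : ‖y - z‖ ≤ 2 * ρ := by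
    have := norm_sub_le y z
    linarith
  have h3 := mul_le_mul_of_nonneg_left h2 hK
  rw [div_le_iff₀ hc0] at hk
  linarith

/-- Averaging makes a Lipschitz function nearly radial on a ball. -/
lemma exists_oscLe_ball (hn : 0 < n) {q K ε : ℝ} (hK : 0 ≤ K)
    (hε : 0 < ε) (H : E n → ℝ) (hH : ∀ y z, ‖y‖ ≤ q → ‖z‖ ≤ q → |H y - H z| ≤ K * ‖y - z‖) :
    ∃ L : List (UnitVec n), ∀ ρ ≤ q, OscLe (realAverageList L H) ρ ε := by
  -- Finitely many radii can be treated in succession, since later averages do not increase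
  -- oscillations already made small.
  have hlist : ∀ l : List ℝ, (∀ ρ ∈ l, 0 ≤ ρ ∧ ρ ≤ q) → ∃ L : List (UnitVec n),
      ∀ ρ ∈ l, OscLe (realAverageList L H) ρ (ε / 2) := by
    intro l
    induction l with
    | nil => exact fun _ => ⟨[], by simp⟩
    | cons ρ l ih =>
      intro hl
      obtain ⟨L, hL⟩ := ih fun r hr => hl r (List.mem_cons_of_mem _ hr)
      obtain ⟨h1, h2⟩ := hl ρ List.mem_cons_self
      obtain ⟨L', hL'⟩ := exists_oscLe_sphere hn h1 h2 hK (half_pos hε) (realAverageList L H)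
        (fun y z hy hz => realAverageList_lipschitz hH y z hy hz)
      refine ⟨L ++ L', fun r hr => ?_⟩
      rw [realAverageList_append]
      rcases List.mem_cons.1 hr with rfl | hr
      · exact hL'
      · exact (hL r hr).realAverageList L'
  -- Moving each of two points radially to a δ-net of radii costs at most ε/4; with oscillation ε/2
  -- on the net the total is ε.
  set δ := ε / (4 * (K + 1)) with hδ
  have hδ0 : 0 < δ := by positivity
  have hKδ : K * δ ≤ ε / 4 := by
    rw [hδ, mul_div_assoc', div_le_div_iff₀ (by positivity) (by norm_num)]
    nlinarith
  obtain ⟨t, hts, htf, htc⟩ := (isCompact_Icc (a := (0 : ℝ)) (b := q)).finite_cover_balls hδ0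
  obtain ⟨L, hL⟩ := hlist htf.toFinset.toList (fun ρ hρ => hts (by simpa using hρ))
  refine ⟨L, fun r hrq y z hy hz => ?_⟩
  have hr0 : 0 ≤ r := hy ▸ norm_nonneg y
  rcases hr0.eq_or_lt with h0 | hr0
  · rw [← h0, norm_eq_zero] at hy hz
    rw [hy, hz]
    linarith
  have hmem := htc (show r ∈ Set.Icc 0 q from ⟨hr0.le, hrq⟩)
  simp only [Set.mem_iUnion] at hmem
  obtain ⟨ρ, hρt, hρ⟩ := hmem
  obtain ⟨hρ0, hρq⟩ := hts hρt
  rw [Metric.mem_ball, Real.dist_eq] at hρ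
  have hscale : ∀ w : E n, ‖w‖ = r → ‖(ρ / r) • w‖ = ρ ∧
      |realAverageList L H w - realAverageList L H ((ρ / r) • w)| ≤ K * δ := by
    intro w hw
    have h1 : ‖(ρ / r) • w‖ = ρ := by
      rw [norm_smul, Real.norm_of_nonneg (by positivity), hw, div_mul_cancel₀ _ hr0.ne']
    refine ⟨h1, (realAverageList_lipschitz hH _ _ (hw.trans_le hrq) (h1.trans_le hρq)).trans ?_⟩
    refine mul_le_mul_of_nonneg_left ?_ hK
    have : w - (ρ / r) • w = ((r - ρ) / r) • w := by
      rw [sub_div, div_self hr0.ne', sub_smul, one_smul]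
    rw [this, norm_smul, hw, Real.norm_eq_abs, abs_div, abs_of_pos hr0, div_mul_cancel₀ _ hr0.ne']
    exact hρ.le
  obtain ⟨hy1, hy2⟩ := hscale y hy
  obtain ⟨hz1, hz2⟩ := hscale z hz
  have := hL ρ (by simpa using hρt) _ _ hy1 hz1
  rw [abs_le] at hy2 hz2
  linarith [hy2.1, hy2.2, hz2.1, hz2.2]

end Averaging

/-! ### Concatenating finite blocks into one sequence -/

section Blocks

/-- If each of countably many persistent properties of finite lists can be achieved by extending a
given list, then a single sequence achieves all of them. -/
lemma exists_seq_of_blocks {α : Type*} [Inhabited α] (P : ℕ → List α → Prop)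
    (hext : ∀ i L, ∃ L', P i (L ++ L')) (hpres : ∀ i L a, P i L → P i (L ++ [a])) :
    ∃ u : ℕ → α, ∀ i, ∀ᶠ m in atTop, P i ((List.range m).map u) := by
  choose ext hext using hext
  -- The padding by `default` makes the i-th list have length at least i, so that every entry of the
  -- limit sequence is defined even if all extensions are empty.
  set s : ℕ → List α := fun i => Nat.rec [] (fun i L => L ++ ext i L ++ [default]) i
  have hsucc : ∀ i, s (i + 1) = s i ++ ext i (s i) ++ [default] := fun i => rfl
  clear_value s
  have hpre : ∀ i j, i ≤ j → s i <+: s j := by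
    intro i j hij
    induction j, hij using Nat.le_induction with
    | base => exact List.prefix_rfl
    | succ j _ ih =>
      refine ih.trans ?_
      rw [hsucc, List.append_assoc]
      exact List.prefix_append _ _
  have hlen : ∀ i, i ≤ (s i).length := by
    intro i
    induction i with
    | zero => exact Nat.zero_le _
    | succ i ih => rw [hsucc]; simp; omega
  set u : ℕ → α := fun m => (s (m + 1))[m]'(hlen (m + 1))
  have hget : ∀ i k (hk : k < (s i).length), u k = (s i)[k] := by
    intro i k hk
    rcases le_total i (k + 1) with h | h
    · exact ((hpre _ _ h).getElem hk).symm
    · exact (hpre _ _ h).getElem (hlen (k + 1))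
  clear_value u
  have hmap : ∀ i, (List.range (s i).length).map u = s i := by
    intro i
    refine List.ext_getElem (by simp) fun k h1 h2 => ?_
    simp [hget i k h2]
  refine ⟨u, fun i => eventually_atTop.2 ⟨(s (i + 1)).length, fun m hm => ?_⟩⟩
  induction m, hm using Nat.le_induction with
  | base =>
    rw [hmap, hsucc]
    exact hpres _ _ _ (hext i _)
  | succ m _ ih =>
    rw [List.range_succ, List.map_append]
    exact hpres _ _ _ ih

end Blocks

/-! ### The symmetrizing sequence of reflections -/

section Sequence

variable {n : ℕ}

lemma conj_iterSymmetral {ψ : E n → EReal} (h : IsBddConvex ψ) (u : ℕ → UnitVec n) (m : ℕ) :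
    conj (iterSymmetral (fun i => (u i).1) ψ m) = averageList ((List.range m).map u) (conj ψ) := by
  induction m with
  | zero => rfl
  | succ m ih =>
    rw [List.range_succ, List.map_append, averageList_append, ← ih]
    exact conj_symmetral (u m).2 (h.iterSymmetral (fun i => (u i).2) m)

/-- A conjugate which is finite on a ball is Lipschitz on smaller balls. -/
lemma exists_lipschitz_conj {ψ : E n → EReal} (h : IsBddConvex ψ) {q ρ : ℝ} (hq : q < ρ)
    (hfin : ∀ z : E n, ‖z‖ ≤ ρ → conj ψ z ≠ ⊤) :
    ∃ K : ℝ, 0 ≤ K ∧ ∀ y z : E n, ‖y‖ ≤ q → ‖z‖ ≤ q →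
      |(conj ψ y).toReal - (conj ψ z).toReal| ≤ K * ‖y - z‖ := by
  have hcoe : ∀ z : E n, ‖z‖ ≤ ρ → conj ψ z = ((conj ψ z).toReal : EReal) := fun z hz =>
    (EReal.coe_toReal (hfin z hz) (h.conj_ne_bot z)).symm
  have hconv : ConvexOn ℝ (Metric.ball (0 : E n) ρ) fun z => (conj ψ z).toReal := by
    refine ⟨convex_ball _ _, fun y hy z hz s t hs ht hst => ?_⟩
    have hmem := convex_ball (0 : E n) ρ hy hz hs ht hst
    rw [mem_ball_zero_iff] at hy hz hmem
    have := conj_convex (hcoe y hy.le).le (hcoe z hz.le).le hs ht hst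
    rw [hcoe _ hmem.le, EReal.coe_le_coe_iff] at this
    exact this
  -- Two intermediate radii: continuity gives boundedness on the closed q₁-ball, and boundedness
  -- gives a Lipschitz bound on the smaller q₂-ball.
  obtain ⟨q₁, hq₁, hq₁ρ⟩ := exists_between hq
  obtain ⟨q₂, hq₂, hq₂q₁⟩ := exists_between hq₁
  have hbdd : Bornology.IsBounded ((fun z => (conj ψ z).toReal) '' Metric.ball (0 : E n) q₁) := by
    have hcomp : IsCompact ((fun z => (conj ψ z).toReal) '' Metric.closedBall (0 : E n) q₁) :=
      (isCompact_closedBall (0 : E n) q₁).image_of_continuousOn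
        ((hconv.continuousOn Metric.isOpen_ball).mono (Metric.closedBall_subset_ball hq₁ρ))
    exact hcomp.isBounded.subset (Set.image_mono Metric.ball_subset_closedBall)
  obtain ⟨K, hK⟩ := (hconv.subset (Metric.ball_subset_ball hq₁ρ.le)
    (convex_ball _ _)).exists_lipschitzOnWith_of_isBounded hq₂q₁ hbdd
  refine ⟨K, K.2, fun y z hy hz => ?_⟩
  have := hK.dist_le_mul y (by simpa using hy.trans_lt hq₂) z (by simpa using hz.trans_lt hq₂)
  rwa [Real.dist_eq, dist_eq_norm] at this

/-- If a conjugate is infinite inside a ball, then it is infinite on a cap of its sphere. -/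
lemma exists_cap_eq_top {ψ : E n → EReal} {q ρ₀ : ℝ} (hρ₀ : 0 < ρ₀)
    (hfin : ∀ z : E n, ‖z‖ ≤ ρ₀ → conj ψ z ≠ ⊤) {z : E n} (hz : conj ψ z = ⊤) (hzq : ‖z‖ < q)
    (hb : ∀ y, conj ψ y ≠ ⊥) :
    ∃ (p : E n) (δ : ℝ), ‖p‖ = q ∧ 0 < δ ∧ ∀ y ∈ Metric.ball p δ, conj ψ y = ⊤ := by
  have hz0 : 0 < ‖z‖ := by
    by_contra! h0
    exact hfin z (h0.trans hρ₀.le) hz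
  have hq0 : 0 < q := hz0.trans hzq
  set t := ‖z‖ / q with ht
  have ht0 : 0 < t := by positivity
  have ht1 : t < 1 := (div_lt_one hq0).2 hzq
  refine ⟨t⁻¹ • z, (1 - t) * ρ₀ / t, ?_, div_pos (mul_pos (by linarith) hρ₀) ht0,
    fun y hy => ?_⟩
  · rw [norm_smul, norm_inv, Real.norm_of_nonneg ht0.le, ht]
    field_simp
  · by_contra hyt
    -- Chosen so that z = ty + (1 - t)w. For y in the cap, w lies in the ball where the conjugate is
    -- finite, so a finite value at y would make the value at z finite.
    set w := (1 - t)⁻¹ • (z - t • y) with hw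
    have ht1' : (1 - t) ≠ 0 := by linarith
    have hwn : ‖w‖ ≤ ρ₀ := by
      rw [Metric.mem_ball, dist_eq_norm] at hy
      have e : z - t • y = (-t) • (y - t⁻¹ • z) := by
        rw [smul_sub, smul_smul, neg_mul, mul_inv_cancel₀ ht0.ne']
        module
      rw [hw, e, norm_smul, norm_smul, norm_neg, norm_inv, Real.norm_of_nonneg ht0.le,
        Real.norm_of_nonneg (by linarith), inv_mul_le_iff₀ (by linarith)]
      rw [lt_div_iff₀ ht0] at hy
      linarith
    obtain ⟨p, hp⟩ := exists_coe_of_ne (hb y) hyt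
    obtain ⟨r, hr⟩ := exists_coe_of_ne (hb w) (hfin w hwn)
    have := conj_convex hp.le hr.le ht0.le (by linarith : 0 ≤ 1 - t) (by ring)
    rw [hw, smul_smul, mul_inv_cancel₀ ht1', one_smul, add_sub_cancel, hz] at this
    exact absurd (top_le_iff.1 this) (EReal.coe_ne_top _)

/-- There is a sequence of reflections along which the conjugates become radial where the initial
conjugate is finite, and infinite beyond. -/
lemma exists_symmetrizing_seq (hn : 0 < n) {ψ : E n → EReal} (h : IsBddConvex ψ) {ρ₀ : ℝ}
    (hρ₀ : 0 < ρ₀) (hfin : ∀ z : E n, ‖z‖ ≤ ρ₀ → conj ψ z ≠ ⊤) :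
    ∃ u : ℕ → E n, (∀ i, ‖u i‖ = 1) ∧
      (∀ q ρ : ℝ, q < ρ → (∀ z : E n, ‖z‖ ≤ ρ → conj ψ z ≠ ⊤) → ∀ ε > 0, ∀ᶠ m in atTop,
        ∀ y z : E n, ‖y‖ = ‖z‖ → ‖y‖ ≤ q →
          (conj (iterSymmetral u ψ m) y).toReal ≤ (conj (iterSymmetral u ψ m) z).toReal + ε) ∧
      (∀ q : ℝ, (∃ z : E n, ‖z‖ < q ∧ conj ψ z = ⊤) → ∀ᶠ m in atTop,
        ∀ y : E n, q ≤ ‖y‖ → conj (iterSymmetral u ψ m) y = ⊤) := by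
  obtain ⟨v, hv⟩ := exists_norm_eq_one hn
  have : Inhabited (UnitVec n) := ⟨⟨v, hv⟩⟩
  obtain ⟨e, he⟩ := exists_surjective_nat (ℚ × ℕ)
  set H : E n → ℝ := fun y => (conj ψ y).toReal with hH
  have hcoe : ∀ q : ℝ, (∀ z : E n, ‖z‖ ≤ q → conj ψ z ≠ ⊤) →
      ∀ z : E n, ‖z‖ ≤ q → conj ψ z = H z := fun q hq z hz =>
    (EReal.coe_toReal (hq z hz) (h.conj_ne_bot z)).symm
  -- A rational radius strictly inside the region of finiteness asks for small oscillation, one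
  -- strictly beyond it for the value +∞; at the critical radius itself nothing is demanded.
  let P : ℕ → List (UnitVec n) → Prop := fun i L =>
    ((∃ ρ : ℝ, ((e i).1 : ℝ) < ρ ∧ ∀ z : E n, ‖z‖ ≤ ρ → conj ψ z ≠ ⊤) →
      ∀ ρ ≤ ((e i).1 : ℝ), OscLe (realAverageList L H) ρ (1 / ((e i).2 + 1))) ∧
    ((∃ z : E n, ‖z‖ < ((e i).1 : ℝ) ∧ conj ψ z = ⊤) →
      ∀ y : E n, ‖y‖ = ((e i).1 : ℝ) → averageList L (conj ψ) y = ⊤)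
  have hext : ∀ i L, ∃ L', P i (L ++ L') := by
    intro i L
    set q : ℝ := ((e i).1 : ℝ) with hq
    by_cases hbad : ∃ z : E n, ‖z‖ < q ∧ conj ψ z = ⊤
    · obtain ⟨z, hzq, hz⟩ := hbad
      obtain ⟨p, δ, hp, hδ, htop⟩ := exists_cap_eq_top hρ₀ hfin hz hzq h.conj_ne_bot
      obtain ⟨N, hN⟩ := exists_spread hn q hδ
      obtain ⟨L', -, hL'⟩ := hN p hp
      refine ⟨L', fun hgood => ?_, fun _ y hy => ?_⟩
      · obtain ⟨ρ, hρ, hf⟩ := hgood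
        exact absurd hz (hf z (hzq.le.trans hρ.le))
      · rw [averageList_append]
        exact averageList_eq_top_of_spread (averageList_ne_bot h.conj_ne_bot)
          (fun w hw => averageList_eq_top h.conj_ne_bot (htop w hw)) y (hL' y hy)
    · by_cases hgood : ∃ ρ : ℝ, q < ρ ∧ ∀ z : E n, ‖z‖ ≤ ρ → conj ψ z ≠ ⊤
      · obtain ⟨ρ, hρ, hf⟩ := hgood
        obtain ⟨K, hK0, hK⟩ := exists_lipschitz_conj h hρ hf
        obtain ⟨L', hL'⟩ := exists_oscLe_ball hn hK0 (Nat.one_div_pos_of_nat (n := (e i).2))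
          (realAverageList L H) (fun y z hy hz => realAverageList_lipschitz hK y z hy hz)
        exact ⟨L', fun _ => by rwa [realAverageList_append], fun hb => absurd hb hbad⟩
      · exact ⟨[], fun hg => absurd hg hgood, fun hb => absurd hb hbad⟩
  have hpres : ∀ i L a, P i L → P i (L ++ [a]) := by
    rintro i L a ⟨h1, h2⟩
    refine ⟨fun hg ρ hρ => ?_, fun hb y hy => ?_⟩
    · rw [realAverageList_append]
      exact (h1 hg ρ hρ).realAverageList [a]
    · rw [averageList_append]
      exact averageList_eq_top (averageList_ne_bot h.conj_ne_bot) (h2 hb y hy)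
  obtain ⟨u, hu⟩ := exists_seq_of_blocks P hext hpres
  have hiter : ∀ (q : ℝ), (∀ z : E n, ‖z‖ ≤ q → conj ψ z ≠ ⊤) → ∀ m (y : E n), ‖y‖ ≤ q →
      (conj (iterSymmetral (fun i => (u i).1) ψ m) y).toReal =
        realAverageList ((List.range m).map u) H y := by
    intro q hq m y hy
    rw [conj_iterSymmetral h, averageList_coe (hcoe q hq) y hy, EReal.toReal_coe]
  refine ⟨fun i => (u i).1, fun i => (u i).2, fun q ρ hqρ hf ε hε => ?_, fun q hq => ?_⟩
  · obtain ⟨q', hq', hq'ρ⟩ := exists_rat_btwn hqρ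
    obtain ⟨N, hN⟩ := exists_nat_one_div_lt hε
    obtain ⟨i, hi⟩ := he (q', N)
    filter_upwards [hu i] with m hm y z hyz hy
    have h1 := hm.1 ⟨ρ, by rw [hi]; exact hq'ρ, hf⟩ ‖z‖ (by rw [hi, ← hyz]; exact hy.trans hq'.le)
      y z hyz rfl
    rw [hi] at h1
    have hyρ : ‖y‖ ≤ ρ := hy.trans hqρ.le
    rw [hiter ρ hf m y hyρ, hiter ρ hf m z (hyz ▸ hyρ)]
    linarith
  · obtain ⟨z, hzq, hz⟩ := hq
    obtain ⟨q', hzq', hq'⟩ := exists_rat_btwn hzq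
    obtain ⟨i, hi⟩ := he (q', 0)
    have hq0 : 0 < (q' : ℝ) := (norm_nonneg z).trans_lt hzq'
    filter_upwards [hu i] with m hm y hy
    have h1 := hm.2 ⟨z, by rw [hi]; exact hzq', hz⟩
    rw [hi] at h1
    simp only at h1
    by_contra hyt
    have hy0 : 0 < ‖y‖ := hq0.trans (hq'.trans_le hy)
    -- The point ty lies on the sphere of radius q', where the conjugate is already infinite. As it
    -- is finite at 0, convexity along the ray forces +∞ at y too.
    set t := (q' : ℝ) / ‖y‖ with ht
    have ht0 : 0 < t := by positivity
    have ht1 : t ≤ 1 := (div_le_one hy0).2 (hq'.le.trans hy)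
    have hI := h.iterSymmetral (fun i => (u i).2) m
    have h00 : conj (iterSymmetral (fun i => (u i).1) ψ m) 0 =
        realAverageList ((List.range m).map u) H 0 := by
      rw [conj_iterSymmetral h, averageList_coe (hcoe ρ₀ hfin) 0 (by simpa using hρ₀.le)]
    obtain ⟨p, hp⟩ := exists_coe_of_ne (hI.conj_ne_bot y) hyt
    have h2 := conj_convex hp.le h00.le ht0.le (sub_nonneg.2 ht1) (by ring)
    rw [conj_iterSymmetral h, h1 _ (by
      rw [smul_zero, add_zero, norm_smul, Real.norm_of_nonneg ht0.le, ht,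
        div_mul_cancel₀ _ hy0.ne'])] at h2
    exact absurd (top_le_iff.1 h2) (EReal.coe_ne_top _)

end Sequence

/-! ### From convergence of conjugates to epi-convergence -/

section Limit

variable {n : ℕ}

/-- The supremum of the affine functions `⟨·, y⟩ - H y` over the `y` whose norm is smaller than some
member of `D`. -/
noncomputable def radialConj (D : Set ℝ) (H : E n → ℝ) (x : E n) : EReal :=
  ⨆ y : {y : E n // ∃ ρ ∈ D, ‖y‖ < ρ}, ((inner ℝ x y.1 - H y.1 : ℝ) : EReal)

lemma le_radialConj {D : Set ℝ} {H : E n → ℝ} {y : E n} {ρ : ℝ} (hρ : ρ ∈ D) (hy : ‖y‖ < ρ)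
    (x : E n) : ((inner ℝ x y - H y : ℝ) : EReal) ≤ radialConj D H x :=
  le_iSup (fun y : {y : E n // ∃ ρ ∈ D, ‖y‖ < ρ} => ((inner ℝ x y.1 - H y.1 : ℝ) : EReal))
    ⟨y, ρ, hρ, hy⟩

/-- A slope of norm ρ/2 in the direction of x gives the growth (ρ/2)‖x‖ - C, while minimality of H
at 0 makes the value at the origin finite. -/
lemma isConvC_radialConj {D : Set ℝ} {H : E n → ℝ} {ρ C : ℝ} (hρ : 0 < ρ) (hρD : ρ ∈ D)
    (hC : ∀ y, ‖y‖ < ρ → H y ≤ C) (hmin : ∀ y, (∃ ρ ∈ D, ‖y‖ < ρ) → H 0 ≤ H y) :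
    IsConvC (radialConj D H) where
  convex := by
    refine convex_epigraph_of fun a b p q s t ha hb hs ht hst => iSup_le ?_
    rintro ⟨y, ρ', hρ', hy⟩
    have h1 := (le_radialConj (H := H) hρ' hy a).trans ha.le
    have h2 := (le_radialConj (H := H) hρ' hy b).trans hb.le
    rw [EReal.coe_le_coe_iff] at h1 h2 ⊢
    rw [inner_add_left, real_inner_smul_left, real_inner_smul_left]
    have h3 := mul_le_mul_of_nonneg_left h1 hs
    have h4 := mul_le_mul_of_nonneg_left h2 ht
    have h5 : s * H y + t * H y = H y := by rw [← add_mul, hst, one_mul]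
    linarith
  ne_bot x := ((EReal.bot_lt_coe _).trans_le
    (le_radialConj (H := H) hρD (y := 0) (by simpa using hρ) x)).ne'
  dom_nonempty := by
    refine ⟨0, (lt_of_le_of_lt (iSup_le ?_) (EReal.coe_lt_top (-H 0))).ne⟩
    rintro ⟨y, hy⟩
    rw [EReal.coe_le_coe_iff, inner_zero_left]
    linarith [hmin y hy]
  lsc := lowerSemicontinuous_iSup fun y =>
    (continuous_coe_real_ereal.comp (by fun_prop)).lowerSemicontinuous
  coercive := by
    rw [EReal.tendsto_nhds_top_iff_real]
    intro M
    have hev := (tendsto_norm_cocompact_atTop (E := E n)).eventually_gt_atTop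
      (max 0 ((M + C) / (ρ / 2)))
    filter_upwards [hev] with x hx
    have hx0 : 0 < ‖x‖ := (le_max_left _ _).trans_lt hx
    have hx1 : (M + C) / (ρ / 2) < ‖x‖ := (le_max_right _ _).trans_lt hx
    rw [div_lt_iff₀ (by positivity)] at hx1
    set y := (ρ / 2 / ‖x‖) • x with hy
    have hyn : ‖y‖ < ρ := by
      rw [hy, norm_smul, Real.norm_of_nonneg (by positivity), div_mul_cancel₀ _ hx0.ne']
      linarith
    refine lt_of_lt_of_le (EReal.coe_lt_coe_iff.2 ?_) (le_radialConj (H := H) hρD hyn x)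
    have : inner ℝ x y = ρ / 2 * ‖x‖ := by
      rw [hy, real_inner_smul_right, real_inner_self_eq_norm_sq]
      field_simp
    rw [this]
    linarith [hC y hyn]

lemma rotationInvariant_radialConj {D : Set ℝ} {H : E n → ℝ}
    (hH : ∀ y z, (∃ ρ ∈ D, ‖y‖ < ρ) → ‖y‖ = ‖z‖ → H y = H z) :
    RotationInvariant (radialConj D H) := by
  have key : ∀ (T : E n ≃ₗᵢ[ℝ] E n) (x : E n), radialConj D H (T x) ≤ radialConj D H x := by
    intro T x
    refine iSup_le ?_
    rintro ⟨y, ρ, hρ, hy⟩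
    have hn : ‖T.symm y‖ = ‖y‖ := T.symm.norm_map y
    have := le_radialConj (H := H) hρ (hn.trans_lt hy) x
    rw [← hH y (T.symm y) ⟨ρ, hρ, hy⟩ hn.symm, ← T.inner_map_map, T.apply_symm_apply] at this
    exact this
  intro T x
  refine le_antisymm (key T x) ?_
  have := key T.symm (T x)
  rwa [T.symm_apply_apply] at this

/-- A diagonal choice: at stage m the point realizes the best tolerance 1/(k+1) with k ≤ m that is
available there. -/
lemma exists_seq_of_eventually {ψs : ℕ → E n → EReal} {x : E n} {a : ℝ}
    (h : ∀ ε > 0, ∀ᶠ m in atTop, ∃ z, ‖z - x‖ ≤ ε ∧ ψs m z ≤ ((a + ε : ℝ) : EReal)) :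
    ∃ xs : ℕ → E n, Tendsto xs atTop (𝓝 x) ∧
      ∀ ε > 0, ∀ᶠ m in atTop, ψs m (xs m) ≤ ((a + ε : ℝ) : EReal) := by
  classical
  set Q : ℕ → ℕ → Prop := fun m k =>
    ∃ z, ‖z - x‖ ≤ 1 / ((k : ℝ) + 1) ∧ ψs m z ≤ ((a + 1 / ((k : ℝ) + 1) : ℝ) : EReal) with hQ
  set k : ℕ → ℕ := fun m => Nat.findGreatest (Q m) m with hk
  have hx : ∀ m, ∃ z, Q m (k m) → ‖z - x‖ ≤ 1 / ((k m : ℝ) + 1) ∧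
      ψs m z ≤ ((a + 1 / ((k m : ℝ) + 1) : ℝ) : EReal) := fun m => by
    by_cases hm : Q m (k m)
    · obtain ⟨z, hz⟩ := hm
      exact ⟨z, fun _ => hz⟩
    · exact ⟨x, fun h => absurd h hm⟩
  choose xs hxs using hx
  have hev : ∀ ε > 0, ∀ᶠ m in atTop, ‖xs m - x‖ < ε ∧ ψs m (xs m) ≤ ((a + ε : ℝ) : EReal) := by
    intro ε hε
    obtain ⟨K, hK⟩ := exists_nat_one_div_lt hε
    filter_upwards [h (1 / ((K : ℝ) + 1)) (by positivity), eventually_ge_atTop K] with m hm hKm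
    have hmK : Q m K := hm
    have h1 : K ≤ k m := Nat.le_findGreatest hKm hmK
    have h2 : Q m (k m) := Nat.findGreatest_spec hKm hmK
    obtain ⟨h3, h4⟩ := hxs m h2
    have h5 : 1 / ((k m : ℝ) + 1) ≤ 1 / ((K : ℝ) + 1) := by
      have : (K : ℝ) ≤ k m := by exact_mod_cast h1
      gcongr
    exact ⟨by linarith, h4.trans (EReal.coe_le_coe_iff.2 (by linarith))⟩
  refine ⟨xs, ?_, fun ε hε => (hev ε hε).mono fun m hm => hm.2⟩
  rw [Metric.tendsto_nhds]
  intro ε hε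
  filter_upwards [hev ε hε] with m hm
  rw [dist_eq_norm]
  exact hm.1

/-- Radii of finiteness of the limit control the slopes which the approximants use. -/
lemma exists_radius {ψs : ℕ → E n → EReal} {D : Set ℝ} (hpos : ∃ ρ ∈ D, 0 < ρ)
    (hbad : ∀ q : ℝ, (∃ ρ < q, ρ ∉ D) → ∀ᶠ m in atTop, ∀ y : E n, q ≤ ‖y‖ → conj (ψs m) y = ⊤)
    {θ : ℝ} (hθ : 0 < θ) (hθ1 : θ < 1) (s : ℝ) :
    ∃ q, 0 ≤ q ∧ (∃ ρ ∈ D, q < ρ) ∧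
      ∀ᶠ m in atTop, ∀ y : E n, ‖y‖ ≤ s → conj (ψs m) y ≠ ⊤ → θ * ‖y‖ ≤ q := by
  obtain ⟨ρ₀, hρ₀, hρ₀0⟩ := hpos
  by_cases hs : ∃ ρ ∈ D, θ * s < ρ
  · obtain ⟨ρ, hρ, hsρ⟩ := hs
    by_cases h0 : 0 ≤ θ * s
    · exact ⟨θ * s, h0, ⟨ρ, hρ, hsρ⟩,
        Eventually.of_forall fun m y hy _ => mul_le_mul_of_nonneg_left hy hθ.le⟩
    · exact ⟨0, le_rfl, ⟨ρ₀, hρ₀, hρ₀0⟩, Eventually.of_forall fun m y hy _ =>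
        (mul_le_mul_of_nonneg_left hy hθ.le).trans (not_le.1 h0).le⟩
  -- Here D is bounded with supremum r. For q between θr and r, the radius q/θ exceeds r, so
  -- finiteness of the conjugate at y eventually forces ‖y‖ < q/θ.
  · push Not at hs
    have hbdd : BddAbove D := ⟨θ * s, hs⟩
    set r := sSup D with hr
    have hr0 : 0 < r := hρ₀0.trans_le (le_csSup hbdd hρ₀)
    obtain ⟨q, hq1, hq2⟩ := exists_between (show θ * r < r by nlinarith)
    obtain ⟨ρ, hρ, hqρ⟩ := exists_lt_of_lt_csSup ⟨ρ₀, hρ₀⟩ hq2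
    have hrq : r < q / θ := by rwa [lt_div_iff₀ hθ, mul_comm]
    obtain ⟨ρ', h1, h2⟩ := exists_between hrq
    refine ⟨q, (mul_pos hθ hr0).le.trans hq1.le, ⟨ρ, hρ, hqρ⟩, ?_⟩
    filter_upwards [hbad (q / θ) ⟨ρ', h2, fun h => (le_csSup hbdd h).not_gt h1⟩] with m hm y _ hy
    by_contra! hlt
    refine hy (hm y ?_)
    rw [div_le_iff₀ hθ, mul_comm]
    exact hlt.le

/-- Convergence of the conjugates, uniform where the limit is finite, with blow-up elsewhere, entails
epi-convergence. -/
lemma epiConverges_radialConj {ψs : ℕ → E n → EReal} {D : Set ℝ} {H : E n → ℝ}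
    (hψ : ∀ m, IsBddConvex (ψs m)) (hlow : ∃ c : ℝ, ∀ m x, (c : EReal) ≤ ψs m x)
    (hpos : ∃ ρ ∈ D, 0 < ρ) (hfin : ∀ ρ ∈ D, ∀ m z, ‖z‖ ≤ ρ → conj (ψs m) z ≠ ⊤)
    (hunif : ∀ q, (∃ ρ ∈ D, q < ρ) → TendstoUniformlyOn (fun m y => (conj (ψs m) y).toReal) H atTop
      (Metric.closedBall (0 : E n) q))
    (hbad : ∀ q : ℝ, (∃ ρ < q, ρ ∉ D) → ∀ᶠ m in atTop, ∀ y : E n, q ≤ ‖y‖ →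
      conj (ψs m) y = ⊤) :
    EpiConverges ψs (radialConj D H) := by
  have hcoe : ∀ y, (∃ ρ ∈ D, ‖y‖ < ρ) → ∀ m, conj (ψs m) y = ((conj (ψs m) y).toReal : EReal) := by
    rintro y ⟨ρ, hρ, hy⟩ m
    exact (EReal.coe_toReal (hfin ρ hρ m y hy.le) ((hψ m).conj_ne_bot y)).symm
  have hlim : ∀ y, (∃ ρ ∈ D, ‖y‖ < ρ) →
      Tendsto (fun m => (conj (ψs m) y).toReal) atTop (𝓝 (H y)) := fun y hy =>
    (hunif ‖y‖ hy).tendsto_at (by simp)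
  have hliminf : ∀ (x : E n) (xs : ℕ → E n), Tendsto xs atTop (𝓝 x) →
      radialConj D H x ≤ liminf (fun j => ψs j (xs j)) atTop := by
    intro x xs hxs
    refine iSup_le ?_
    rintro ⟨y, hy⟩
    have h1 : Tendsto (fun m => ((inner ℝ (xs m) y - (conj (ψs m) y).toReal : ℝ) : EReal)) atTop
        (𝓝 ((inner ℝ x y - H y : ℝ) : EReal)) :=
      EReal.tendsto_coe.2 ((hxs.inner tendsto_const_nhds).sub (hlim y hy))
    rw [← h1.liminf_eq]
    exact liminf_le_liminf (Eventually.of_forall fun m => le_of_conj_le (hcoe y hy m).le _)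
  intro x
  refine ⟨hliminf x, ?_⟩
  rcases eq_or_ne (radialConj D H x) ⊤ with htop | htop
  · refine ⟨fun _ => x, tendsto_const_nhds, ?_⟩
    have := hliminf x (fun _ => x) tendsto_const_nhds
    rw [htop] at this ⊢
    exact tendsto_of_le_liminf_of_limsup_le this le_top
  have hzero : ∃ ρ ∈ D, ‖(0 : E n)‖ < ρ := by simpa using hpos
  obtain ⟨a, ha⟩ := exists_coe_of_ne (a := radialConj D H x) (by
    obtain ⟨ρ, hρ, h0⟩ := hzero
    exact ((EReal.bot_lt_coe _).trans_le (le_radialConj (H := H) hρ h0 x)).ne') htop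
  have haff : ∀ y, (∃ ρ ∈ D, ‖y‖ < ρ) → inner ℝ x y - H y ≤ a := by
    rintro y ⟨ρ, hρ, hy⟩
    rw [← EReal.coe_le_coe_iff, ← ha]
    exact le_radialConj hρ hy x
  obtain ⟨c, hc⟩ := hlow
  -- No slope of bounded norm can eventually certify the value a + ε at x. Such a slope, shrunk by 1
  -- - κ, enters a ball of uniform convergence, where the limit H certifies at most a; convexity
  -- between y and 0 makes the shrinking cost small.
  have hconj : ∀ ε > 0, ∀ s : ℝ, ∀ᶠ m in atTop, ∀ y : E n, ‖y‖ ≤ s →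
      ¬ conj (ψs m) y ≤ ((inner ℝ x y - (a + ε) : ℝ) : EReal) := by
    intro ε hε s
    set A := |a + H 0| + ε / 4 with hA
    have hA0 : 0 < A := by positivity
    -- The comparison leaves (1 - κ)ε - ε/4 ≤ κA, which κ ≤ 1/2 and κA ≤ ε/8 contradict.
    set κ := min (1 / 2) (ε / (8 * A)) with hκ
    have hκ0 : 0 < κ := by positivity
    have hκ1 : κ ≤ 1 / 2 := min_le_left _ _
    have hκ2 : κ * A ≤ ε / 8 := by
      calc κ * A ≤ ε / (8 * A) * A := by gcongr; exact min_le_right _ _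
        _ = ε / 8 := by field_simp
    obtain ⟨q, hq0, hqD, hq⟩ := exists_radius hpos hbad (θ := 1 - κ) (by linarith) (by linarith) s
    have hu := Metric.tendstoUniformlyOn_iff.1 (hunif q hqD) (ε / 4) (by positivity)
    filter_upwards [hq, hu] with m hm hmu y hys hle
    have hyn := hm y hys (hle.trans_lt (EReal.coe_lt_top _)).ne
    set w := (1 - κ) • y + κ • (0 : E n) with hw
    have hwn : ‖w‖ ≤ q := by
      rw [hw, smul_zero, add_zero, norm_smul, Real.norm_of_nonneg (by linarith)]
      exact hyn
    have hwD : ∃ ρ ∈ D, ‖w‖ < ρ := by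
      obtain ⟨ρ, hρ, hqρ⟩ := hqD
      exact ⟨ρ, hρ, hwn.trans_lt hqρ⟩
    have h1 := conj_convex hle (hcoe 0 hzero m).le (by linarith : 0 ≤ 1 - κ) hκ0.le (by ring)
    rw [← hw, hcoe w hwD m, EReal.coe_le_coe_iff] at h1
    have h2 := hmu w (by simpa using hwn)
    have h3 := hmu 0 (by simpa using hq0)
    rw [Real.dist_eq, abs_lt] at h2 h3
    have h4 := haff w hwD
    have h5 : inner ℝ x w = (1 - κ) * inner ℝ x y := by
      rw [hw, smul_zero, add_zero, real_inner_smul_right]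
    have h6 : κ * (a + H 0) ≤ κ * |a + H 0| := mul_le_mul_of_nonneg_left (le_abs_self _) hκ0.le
    have h7 : κ * (conj (ψs m) 0).toReal ≤ κ * (H 0 + ε / 4) :=
      mul_le_mul_of_nonneg_left (by linarith [h3.1]) hκ0.le
    have h8 : κ * ε ≤ 1 / 2 * ε := mul_le_mul_of_nonneg_right hκ1 hε.le
    rw [hA, mul_add] at hκ2
    rw [h5] at h4
    linarith [h2.1, h2.2]
  obtain ⟨xs, hxs, hup⟩ := exists_seq_of_eventually (ψs := ψs) (x := x) (a := a) (by
    intro ε hε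
    -- Were the function above a + ε on the ε-ball about x, the global bound c would place it above
    -- a cone of slope s with apex (x, a + ε); `exists_conj_le` would then produce a slope just
    -- excluded.
    set s := max 0 ((a + ε - c) / ε) with hs
    have hs0 : 0 ≤ s := le_max_left _ _
    have hs1 : a + ε - c ≤ s * ε := by
      rw [← div_le_iff₀ hε]
      exact le_max_right _ _
    filter_upwards [hconj ε hε s] with m hm
    by_contra! hno
    obtain ⟨y, hy, hle⟩ := exists_conj_le (hψ m) (x := x) (t := a + ε) hs0 (fun z => by
      by_cases hz : ‖z - x‖ ≤ ε
      · refine le_trans (EReal.coe_le_coe_iff.2 ?_) (hno z hz).le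
        have : 0 ≤ s * ‖z - x‖ := by positivity
        linarith
      · refine le_trans (EReal.coe_le_coe_iff.2 ?_) (hc m z)
        have := mul_le_mul_of_nonneg_left (not_le.1 hz).le hs0
        linarith)
    exact hm y hy hle)
  refine ⟨xs, hxs, tendsto_of_le_liminf_of_limsup_le (hliminf x xs hxs) ?_⟩
  rw [ha]
  refine EReal.le_of_forall_lt_iff_le.1 fun z hz => ?_
  have hz' : a < z := EReal.coe_lt_coe_iff.1 hz
  refine limsup_le_of_le (by isBoundedDefault) ((hup (z - a) (by linarith)).mono fun m hm => ?_)
  rwa [add_sub_cancel] at hm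

end Limit

/-! ### Existence of epi-symmetrizations -/

section EpiSymmetrization

variable {n : ℕ}

lemma conj_iterSymmetral_succ {ψ : E n → EReal} (h : IsBddConvex ψ) {u : ℕ → E n}
    (hu : ∀ i, ‖u i‖ = 1) (m : ℕ) : conj (iterSymmetral u ψ (m + 1)) =
      average (u m) (conj (iterSymmetral u ψ m)) :=
  conj_symmetral (hu m) (h.iterSymmetral hu m)

lemma conj_iterSymmetral_ne_top {ψ : E n → EReal} (h : IsBddConvex ψ) {u : ℕ → E n}
    (hu : ∀ i, ‖u i‖ = 1) {ρ : ℝ} (hfin : ∀ z : E n, ‖z‖ ≤ ρ → conj ψ z ≠ ⊤) (m : ℕ) (z : E n)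
    (hz : ‖z‖ ≤ ρ) : conj (iterSymmetral u ψ m) z ≠ ⊤ := by
  induction m generalizing z with
  | zero => exact hfin z hz
  | succ m ih =>
    have hb := (h.iterSymmetral hu m).conj_ne_bot
    obtain ⟨p, hp⟩ := exists_coe_of_ne (hb z) (ih z hz)
    obtain ⟨q, hq⟩ := exists_coe_of_ne (hb (reflect (u m) z)) (ih _ (by rwa [norm_reflect (hu m)]))
    rw [conj_iterSymmetral_succ h hu, average_coe hp hq]
    exact EReal.coe_ne_top _

lemma toReal_conj_iterSymmetral_succ {ψ : E n → EReal} (h : IsBddConvex ψ) {u : ℕ → E n}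
    (hu : ∀ i, ‖u i‖ = 1) {ρ : ℝ} (hfin : ∀ z : E n, ‖z‖ ≤ ρ → conj ψ z ≠ ⊤) (m : ℕ) (z : E n)
    (hz : ‖z‖ ≤ ρ) : (conj (iterSymmetral u ψ (m + 1)) z).toReal =
      ((conj (iterSymmetral u ψ m) z).toReal +
        (conj (iterSymmetral u ψ m) (reflect (u m) z)).toReal) / 2 := by
  have hb := (h.iterSymmetral hu m).conj_ne_bot
  have ht := conj_iterSymmetral_ne_top h hu hfin m
  rw [conj_iterSymmetral_succ h hu, average_coe (EReal.coe_toReal (ht z hz) (hb z)).symm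
    (EReal.coe_toReal (ht _ (by rwa [norm_reflect (hu m)])) (hb _)).symm, EReal.toReal_coe]

/-- Averages of functions which become radial form a uniform Cauchy sequence. -/
lemma uniformCauchySeqOn_of_average {F : ℕ → E n → ℝ} {u : ℕ → E n} (hu : ∀ i, ‖u i‖ = 1) {q : ℝ}
    (hF : ∀ m y, ‖y‖ ≤ q → F (m + 1) y = (F m y + F m (reflect (u m) y)) / 2)
    (hrad : ∀ ε > 0, ∀ᶠ m in atTop, ∀ y z : E n, ‖y‖ = ‖z‖ → ‖y‖ ≤ q → F m y ≤ F m z + ε) :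
    UniformCauchySeqOn F atTop (Metric.closedBall (0 : E n) q) := by
  rw [Metric.uniformCauchySeqOn_iff]
  intro ε hε
  obtain ⟨M, hM⟩ := (hrad (ε / 3) (by positivity)).exists
  -- Once all values on a sphere lie within ε/3 of F M y, averages stay there; letting z range over
  -- the whole sphere is what makes the induction pass through reflections.
  have key : ∀ m ≥ M, ∀ y z : E n, ‖y‖ = ‖z‖ → ‖y‖ ≤ q → |F m z - F M y| ≤ ε / 3 := by
    intro m hm
    induction m, hm using Nat.le_induction with
    | base =>
      intro y z hyz hy
      have h1 := hM y z hyz hy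
      have h2 := hM z y hyz.symm (hyz ▸ hy)
      rw [abs_le]
      constructor <;> linarith
    | succ m _ ih =>
      intro y z hyz hy
      have h1 := ih y z hyz hy
      have h2 := ih y (reflect (u m) z) (by rwa [norm_reflect (hu m)]) hy
      rw [hF m z (hyz ▸ hy)]
      rw [abs_le] at *
      constructor <;> linarith [h1.1, h1.2, h2.1, h2.2]
  refine ⟨M, fun m hm k hk y hy => ?_⟩
  have hy' : ‖y‖ ≤ q := by simpa using hy
  have h1 := key m hm y y rfl hy'
  have h2 := key k hk y y rfl hy'
  rw [Real.dist_eq]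
  rw [abs_le] at h1 h2
  rw [abs_lt]
  constructor <;> linarith [h1.1, h1.2, h2.1, h2.2]

/-- Every member of `Conv_c` has an epi-symmetrization. -/
theorem exists_epiSymmetrization (hn : 0 < n) {ψ : E n → EReal} (h : IsConvC ψ) :
    ∃ φ : E n → EReal, IsEpiSymmetrization ψ φ := by
  have hψ := h.isBddConvex
  obtain ⟨ρ₀, C, hρ₀, hgrow⟩ := h.exists_linear_growth
  have hconjC : ∀ y : E n, ‖y‖ ≤ ρ₀ → conj ψ y ≤ (C : EReal) := by
    intro y hy
    rw [conj_le_iff]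
    intro x
    refine le_trans (EReal.coe_le_coe_iff.2 ?_) (hgrow x)
    have := (real_inner_le_norm x y).trans (mul_le_mul_of_nonneg_left hy (norm_nonneg x))
    linarith
  set D : Set ℝ := {ρ | ∀ z : E n, ‖z‖ ≤ ρ → conj ψ z ≠ ⊤} with hD
  have hρ₀D : ρ₀ ∈ D := fun z hz => ((hconjC z hz).trans_lt (EReal.coe_lt_top _)).ne
  obtain ⟨u, hu, hgood, hbad⟩ := exists_symmetrizing_seq hn hψ hρ₀ hρ₀D
  set F : ℕ → E n → ℝ := fun m y => (conj (iterSymmetral u ψ m) y).toReal with hF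
  have hcauchy : ∀ q, (∃ ρ ∈ D, q < ρ) →
      UniformCauchySeqOn F atTop (Metric.closedBall (0 : E n) q) := by
    rintro q ⟨ρ, hρ, hq⟩
    exact uniformCauchySeqOn_of_average hu
      (fun m y hy => toReal_conj_iterSymmetral_succ hψ hu hρ m y (hy.trans hq.le)) (hgood q ρ hq hρ)
  have hlim : ∀ y : E n, ∃ l : ℝ, (∃ ρ ∈ D, ‖y‖ < ρ) → Tendsto (fun m => F m y) atTop (𝓝 l) := by
    intro y
    by_cases hy : ∃ ρ ∈ D, ‖y‖ < ρ
    · obtain ⟨l, hl⟩ := cauchySeq_tendsto_of_complete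
        ((hcauchy ‖y‖ hy).cauchySeq (x := y) (by simp))
      exact ⟨l, fun _ => hl⟩
    · exact ⟨0, fun h => absurd h hy⟩
  choose H hH using hlim
  have hunif : ∀ q, (∃ ρ ∈ D, q < ρ) →
      TendstoUniformlyOn F H atTop (Metric.closedBall (0 : E n) q) := fun q hq =>
    (hcauchy q hq).tendstoUniformlyOn_of_tendsto fun y hy => hH y (by
      obtain ⟨ρ, hρ, hqρ⟩ := hq
      exact ⟨ρ, hρ, (mem_closedBall_zero_iff.1 hy).trans_lt hqρ⟩)
  have hradle : ∀ y z, (∃ ρ ∈ D, ‖y‖ < ρ) → ‖y‖ = ‖z‖ → H y ≤ H z := by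
    intro y z hy hyz
    have hyD := hy
    obtain ⟨ρ, hρ, hyρ⟩ := hyD
    refine le_of_forall_pos_le_add fun ε hε => ?_
    refine le_of_tendsto_of_tendsto (hH y hy) ((hH z (hyz ▸ hy)).add_const ε) ?_
    filter_upwards [hgood ‖y‖ ρ hyρ hρ ε hε] with m hm
    exact hm y z hyz le_rfl
  have hrad : ∀ y z, (∃ ρ ∈ D, ‖y‖ < ρ) → ‖y‖ = ‖z‖ → H y = H z := fun y z hy hyz =>
    le_antisymm (hradle y z hy hyz) (hradle z y (hyz ▸ hy) hyz.symm)
  have hcoe : ∀ y, (∃ ρ ∈ D, ‖y‖ < ρ) → ∀ m, conj (iterSymmetral u ψ m) y = (F m y : EReal) := by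
    rintro y ⟨ρ, hρ, hy⟩ m
    exact (EReal.coe_toReal (conj_iterSymmetral_ne_top hψ hu hρ m y hy.le)
      ((hψ.iterSymmetral hu m).conj_ne_bot y)).symm
  have hzero : ∃ ρ ∈ D, ‖(0 : E n)‖ < ρ := ⟨ρ₀, hρ₀D, by simpa using hρ₀⟩
  refine ⟨radialConj D H, isConvC_radialConj (C := C) hρ₀ hρ₀D ?_ ?_,
    rotationInvariant_radialConj hrad, u, hu, epiConverges_radialConj (hψ.iterSymmetral hu) ?_
      ⟨ρ₀, hρ₀D, hρ₀⟩ (fun ρ hρ m z hz => conj_iterSymmetral_ne_top hψ hu hρ m z hz) hunif ?_⟩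
  · intro y hy
    refine le_of_tendsto (hH y ⟨ρ₀, hρ₀D, hy⟩) (Eventually.of_forall fun m => ?_)
    have key : ∀ m, ∀ z : E n, ‖z‖ ≤ ρ₀ → F m z ≤ C := by
      intro m
      induction m with
      | zero =>
        intro z hz
        rw [← EReal.coe_le_coe_iff]
        exact (EReal.coe_toReal (hρ₀D z hz) (hψ.conj_ne_bot z)).le.trans (hconjC z hz)
      | succ m ih =>
        intro z hz
        have h1 := toReal_conj_iterSymmetral_succ hψ hu hρ₀D m z hz
        have h2 := ih z hz
        have h3 := ih (reflect (u m) z) (by rwa [norm_reflect (hu m)])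
        simp only [hF] at h1 h2 h3 ⊢
        linarith
    exact key m y hy.le
  · intro y hy
    have hy' : ∃ ρ ∈ D, ‖-y‖ < ρ := by rwa [norm_neg]
    -- Convexity passes to the limit, and radiality gives H (-y) = H y, so H is minimal at 0.
    have h1 : H 0 ≤ (1 / 2) * H y + (1 / 2) * H (-y) := by
      refine le_of_tendsto_of_tendsto' (hH 0 hzero)
        (((hH y hy).const_mul _).add ((hH (-y) hy').const_mul _)) fun m => ?_
      have := conj_convex (hcoe y hy m).le (hcoe (-y) hy' m).le (s := 1 / 2) (t := 1 / 2)
        (by norm_num) (by norm_num) (by norm_num)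
      rwa [smul_neg, add_neg_cancel, hcoe 0 hzero m, EReal.coe_le_coe_iff] at this
    rw [hrad (-y) y hy' (norm_neg y)] at h1
    linarith
  · obtain ⟨c, hc⟩ := hψ.bddBelow
    exact ⟨c, fun m x => le_iterSymmetral hu hc m x⟩
  · rintro q ⟨ρ, hρq, hρ⟩
    simp only [hD, Set.mem_ofPred_eq, not_forall, not_not] at hρ
    obtain ⟨z, hz, hzt⟩ := hρ
    exact hbad q ⟨z, hz.trans_lt hρq, hzt⟩

end EpiSymmetrization

/-! ### The scalar correspondence between functions and base values -/

section Scalar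

/-- The scalar function `a ↦ (1 - α a)_+^{1/α}`, so that `ofBase α ψ = profile α ∘ ψ`. -/
noncomputable def profile (α : ℝ) (a : EReal) : ℝ :=
  open Classical in
  if a = ⊤ then 0
  else if α = 0 then Real.exp (-a.toReal)
  else (max (1 - α * a.toReal) 0) ^ (1 / α)

/-- The inverse of `profile` on positive numbers. -/
noncomputable def level (α v : ℝ) : ℝ := if α = 0 then -Real.log v else (1 - v ^ α) / α

/-- The strict lower bound of the values of base functions. -/
noncomputable def baseInf (α : ℝ) : EReal := if α < 0 then ((1 / α : ℝ) : EReal) else ⊥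

/-- The value from which on `profile` vanishes. -/
noncomputable def baseSup (α : ℝ) : EReal := if 0 < α then ((1 / α : ℝ) : EReal) else ⊤

variable {α : ℝ}

lemma profile_top : profile α ⊤ = 0 := by simp [profile]

lemma profile_zero_coe (a : ℝ) : profile 0 (a : EReal) = Real.exp (-a) := by simp [profile]

lemma profile_coe (hα : α ≠ 0) (a : ℝ) :
    profile α (a : EReal) = (max (1 - α * a) 0) ^ (1 / α) := by simp [profile, hα]

lemma profile_nonneg (a : EReal) : 0 ≤ profile α a := by
  unfold profile
  split_ifs
  · exact le_rfl
  · positivity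
  · positivity

lemma ofBase_apply {n : ℕ} (ψ : E n → EReal) (x : E n) : ofBase α ψ x = profile α (ψ x) := rfl

lemma one_sub_pos {a : ℝ} (h1 : baseInf α < a) (h2 : (a : EReal) < baseSup α) :
    0 < 1 - α * a := by
  unfold baseInf at h1
  unfold baseSup at h2
  rcases lt_trichotomy α 0 with h | h | h
  · rw [if_pos h, EReal.coe_lt_coe_iff, div_lt_iff_of_neg h] at h1
    linarith
  · simp [h]
  · rw [if_pos h, EReal.coe_lt_coe_iff, lt_div_iff₀ h] at h2
    linarith

lemma profile_coe_of_lt (hα : α ≠ 0) {a : ℝ} (h1 : baseInf α < a) (h2 : (a : EReal) < baseSup α) :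
    profile α (a : EReal) = (1 - α * a) ^ (1 / α) := by
  rw [profile_coe hα, max_eq_left (one_sub_pos h1 h2).le]

lemma ne_top_of_lt_baseSup {a : EReal} (h : a < baseSup α) : a ≠ ⊤ := (h.trans_le le_top).ne

lemma exists_coe_of_lt {a : EReal} (h1 : baseInf α < a) (h2 : a < baseSup α) : ∃ p : ℝ, a = p :=
  exists_coe_of_ne (bot_le.trans_lt h1).ne' (ne_top_of_lt_baseSup h2)

lemma profile_pos {a : EReal} (h1 : baseInf α < a) (h2 : a < baseSup α) : 0 < profile α a := by
  obtain ⟨p, rfl⟩ := exists_coe_of_lt h1 h2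
  rcases eq_or_ne α 0 with rfl | hα
  · rw [profile_zero_coe]; positivity
  · rw [profile_coe_of_lt hα h1 h2]
    exact Real.rpow_pos_of_pos (one_sub_pos h1 h2) _

lemma profile_eq_zero {a : EReal} (h : baseSup α ≤ a) : profile α a = 0 := by
  rcases eq_or_ne a ⊤ with rfl | ha
  · exact profile_top
  unfold baseSup at h
  split_ifs at h with hα
  · obtain ⟨p, rfl⟩ := exists_coe_of_ne ((EReal.bot_lt_coe _).trans_le h).ne' ha
    rw [EReal.coe_le_coe_iff, div_le_iff₀ hα] at h
    rw [profile_coe hα.ne', max_eq_right (by linarith), Real.zero_rpow (by positivity)]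
  · exact absurd (top_le_iff.1 h) ha

lemma profile_ne_zero_iff {a : EReal} (h1 : baseInf α < a) :
    profile α a ≠ 0 ↔ a < baseSup α :=
  ⟨fun h => not_le.1 fun h' => h (profile_eq_zero h'), fun h => (profile_pos h1 h).ne'⟩

/-- The strict lower bound is essential: at -∞, and for α < 0 at or below 1/α, the formula takes
junk values instead of +∞. -/
lemma profile_anti {a b : EReal} (h1 : baseInf α < a) (hab : a ≤ b) :
    profile α b ≤ profile α a := by
  rcases le_or_gt (baseSup α) b with hb | hb
  · rw [profile_eq_zero hb]; exact profile_nonneg _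
  obtain ⟨p, rfl⟩ := exists_coe_of_lt h1 (hab.trans_lt hb)
  obtain ⟨q, rfl⟩ := exists_coe_of_lt (h1.trans_le hab) hb
  have hpq : p ≤ q := EReal.coe_le_coe_iff.1 hab
  have hp := one_sub_pos h1 (hab.trans_lt hb)
  have hq := one_sub_pos (h1.trans_le hab) hb
  rcases lt_trichotomy α 0 with h | rfl | h
  · rw [profile_coe_of_lt h.ne h1 (hab.trans_lt hb), profile_coe_of_lt h.ne (h1.trans_le hab) hb]
    refine Real.rpow_le_rpow_of_nonpos hp ?_ (one_div_nonpos.2 h.le)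
    nlinarith
  · rw [profile_zero_coe, profile_zero_coe]
    exact Real.exp_le_exp.2 (by linarith)
  · rw [profile_coe_of_lt h.ne' h1 (hab.trans_lt hb), profile_coe_of_lt h.ne' (h1.trans_le hab) hb]
    refine Real.rpow_le_rpow hq.le ?_ (by positivity)
    nlinarith

lemma baseInf_lt_level {v : ℝ} (hv : 0 < v) : baseInf α < level α v := by
  unfold baseInf
  split_ifs with h
  · rw [EReal.coe_lt_coe_iff, level, if_neg h.ne, div_lt_div_right_of_neg h]
    linarith [Real.rpow_pos_of_pos hv α]
  · exact EReal.bot_lt_coe _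

lemma level_lt_baseSup {v : ℝ} (hv : 0 < v) : (level α v : EReal) < baseSup α := by
  unfold baseSup
  split_ifs with h
  · rw [EReal.coe_lt_coe_iff, level, if_neg h.ne', div_lt_div_iff_of_pos_right h]
    linarith [Real.rpow_pos_of_pos hv α]
  · exact EReal.coe_lt_top _

lemma profile_level {v : ℝ} (hv : 0 < v) : profile α (level α v) = v := by
  rcases eq_or_ne α 0 with rfl | hα
  · rw [profile_zero_coe, level, if_pos rfl, neg_neg, Real.exp_log hv]
  · rw [profile_coe_of_lt hα (baseInf_lt_level hv) (level_lt_baseSup hv), level, if_neg hα,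
      mul_div_cancel₀ _ hα, sub_sub_cancel, one_div, Real.rpow_rpow_inv hv.le hα]

lemma level_profile {a : ℝ} (h1 : baseInf α < a) (h2 : (a : EReal) < baseSup α) :
    level α (profile α a) = a := by
  rcases eq_or_ne α 0 with rfl | hα
  · rw [profile_zero_coe, level, if_pos rfl, Real.log_exp, neg_neg]
  · rw [profile_coe_of_lt hα h1 h2, level, if_neg hα, one_div,
      Real.rpow_inv_rpow (one_sub_pos h1 h2).le hα, sub_sub_cancel, mul_div_cancel_left₀ _ hα]

lemma level_le_iff {v τ : ℝ} (hv : 0 < v) (hτ : baseInf α < τ) :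
    level α v ≤ τ ↔ profile α τ ≤ v := by
  constructor
  · intro h
    rw [← profile_level (α := α) hv]
    exact profile_anti (baseInf_lt_level hv) (EReal.coe_le_coe_iff.2 h)
  · intro h
    by_contra! hlt
    have hlt' : (τ : EReal) < level α v := EReal.coe_lt_coe_iff.2 hlt
    have h1 := profile_anti hτ hlt'.le
    rw [profile_level hv] at h1
    have h2 := level_profile hτ (hlt'.trans (level_lt_baseSup hv))
    rw [le_antisymm h h1] at h2
    exact hlt.ne h2.symm

lemma continuousAt_profile {a : EReal} (h : baseInf α < a) : ContinuousAt (profile α) a := by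
  rcases eq_or_ne a ⊤ with rfl | ha
  · rw [ContinuousAt, profile_top, Metric.tendsto_nhds]
    intro ε hε
    have hl : (level α (ε / 2) : EReal) < ⊤ := EReal.coe_lt_top _
    filter_upwards [lt_mem_nhds hl] with b hb
    have h1 := profile_anti (baseInf_lt_level (half_pos hε)) hb.le
    rw [profile_level (half_pos hε)] at h1
    rw [Real.dist_eq, sub_zero, abs_of_nonneg (profile_nonneg b)]
    linarith
  · obtain ⟨p, rfl⟩ := exists_coe_of_ne (bot_le.trans_lt h).ne' ha
    rw [ContinuousAt, EReal.nhds_coe, tendsto_map'_iff]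
    rcases eq_or_ne α 0 with rfl | hα
    · have : profile 0 ∘ Real.toEReal = fun t : ℝ => Real.exp (-t) :=
        funext fun t => profile_zero_coe t
      rw [this, profile_zero_coe]
      exact (by fun_prop : Continuous fun t : ℝ => Real.exp (-t)).tendsto p
    · have : profile α ∘ Real.toEReal = fun t : ℝ => (max (1 - α * t) 0) ^ (1 / α) :=
        funext fun t => profile_coe hα t
      rw [this, profile_coe hα]
      refine ContinuousAt.rpow_const (by fun_prop) ?_
      rcases lt_or_gt_of_ne hα with hneg | hpos
      · left
        have := one_sub_pos h (by rw [baseSup, if_neg hneg.le.not_gt]; exact EReal.coe_lt_top _)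
        exact (lt_max_of_lt_left this).ne'
      · right
        positivity

/-- Semicontinuity in usable form: a strict lower bound on ψ becomes an upper bound on the function
it determines. -/
lemma exists_lt_profile_lt {a : EReal} (h : baseInf α < a) {y : ℝ} (hy : profile α a < y) :
    ∃ s < a, ∀ t, s < t → profile α t < y := by
  have hev : ∀ᶠ s in 𝓝 a, profile α s < y := (continuousAt_profile h).eventually (gt_mem_nhds hy)
  obtain ⟨l, hl, hl'⟩ := exists_Ioc_subset_of_mem_nhds hev ⟨_, h⟩
  obtain ⟨s, hs1, hs2⟩ := exists_between (max_lt hl h)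
  refine ⟨s, hs2, fun t ht => ?_⟩
  have h1 : profile α s < y := hl' ⟨(le_max_left _ _).trans_lt hs1, hs2.le⟩
  exact (profile_anti ((le_max_right _ _).trans_lt hs1) ht.le).trans_lt h1

lemma convex_comb_mem {a b s t : ℝ} (ha : baseInf α < a) (hb : baseInf α < b)
    (ha' : (a : EReal) < baseSup α) (hb' : (b : EReal) < baseSup α) (hs : 0 ≤ s) (ht : 0 ≤ t)
    (hst : s + t = 1) :
    baseInf α < ((s * a + t * b : ℝ) : EReal) ∧ ((s * a + t * b : ℝ) : EReal) < baseSup α := by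
  have e : s = 1 - t := by linarith
  subst e
  rcases le_total a b with h | h
  · exact ⟨ha.trans_le (EReal.coe_le_coe_iff.2 (by nlinarith)),
      lt_of_le_of_lt (EReal.coe_le_coe_iff.2 (by nlinarith)) hb'⟩
  · exact ⟨hb.trans_le (EReal.coe_le_coe_iff.2 (by nlinarith)),
      lt_of_le_of_lt (EReal.coe_le_coe_iff.2 (by nlinarith)) ha'⟩

/-- `profile` turns arithmetic means into `α`-means. -/
lemma alphaMean_profile {a b s t : ℝ} (ha : baseInf α < a) (hb : baseInf α < b)
    (ha' : (a : EReal) < baseSup α) (hb' : (b : EReal) < baseSup α) (hs : 0 ≤ s) (ht : 0 ≤ t)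
    (hst : s + t = 1) :
    alphaMean α s t (profile α a) (profile α b) = profile α ((s * a + t * b : ℝ) : EReal) := by
  obtain ⟨h1, h2⟩ := convex_comb_mem ha hb ha' hb' hs ht hst
  rcases eq_or_ne α 0 with rfl | hα
  · rw [alphaMean, if_pos rfl, profile_zero_coe, profile_zero_coe, profile_zero_coe,
      ← Real.exp_mul, ← Real.exp_mul, ← Real.exp_add]
    congr 1
    ring
  · rw [alphaMean, if_neg hα, profile_coe_of_lt hα ha ha', profile_coe_of_lt hα hb hb',
      profile_coe_of_lt hα h1 h2, one_div, Real.rpow_inv_rpow (one_sub_pos ha ha').le hα,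
      Real.rpow_inv_rpow (one_sub_pos hb hb').le hα]
    congr 1
    have : s = 1 - t := by linarith
    subst this
    ring

end Scalar

/-! ### Base functions and their stability under symmetrization -/

section BaseFunctions

variable {n : ℕ} {α : ℝ}

lemma baseSup_of_pos (hα : 0 < α) : baseSup α = ((1 / α : ℝ) : EReal) := if_pos hα

lemma baseSup_of_nonpos (hα : α ≤ 0) : baseSup α = ⊤ := if_neg hα.not_gt

lemma baseFn_of_pos {f : E n → ℝ} {x : E n} (h : 0 < f x) :
    baseFn α f x = (level α (f x) : EReal) := by
  have hcl : x ∈ closure (Function.support f) := subset_closure h.ne'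
  unfold baseFn level
  rcases lt_trichotomy α 0 with hα | rfl | hα
  · simp [hα.not_gt, h.ne', hα.ne]
  · simp [h.ne']
  · simp [hα, hcl, hα.ne']

lemma baseFn_of_eq_zero {f : E n → ℝ} {x : E n} (h : f x = 0) (hα : α ≤ 0) :
    baseFn α f x = ⊤ := by
  simp [baseFn, hα.not_gt, h]

lemma baseFn_of_mem_closure {f : E n → ℝ} {x : E n} (h : f x = 0) (hα : 0 < α)
    (hx : x ∈ closure (Function.support f)) : baseFn α f x = ((1 / α : ℝ) : EReal) := by
  simp [baseFn, hα, hx, h, Real.zero_rpow hα.ne']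

lemma baseFn_of_notMem_closure {f : E n → ℝ} {x : E n} (hα : 0 < α)
    (hx : x ∉ closure (Function.support f)) : baseFn α f x = ⊤ := by
  simp [baseFn, hα, hx]

/-- Functions which are recovered from the function they determine. -/
structure IsBase (α : ℝ) (χ : E n → EReal) : Prop where
  convex : Convex ℝ {p : E n × ℝ | χ p.1 ≤ (p.2 : EReal)}
  lower : ∃ c : ℝ, baseInf α < c ∧ ∀ x, (c : EReal) ≤ χ x
  compact_dom : 0 < α → IsCompact {x | χ x ≠ ⊤}
  upper : 0 < α → ∀ x, χ x ≠ ⊤ → χ x ≤ ((1 / α : ℝ) : EReal)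
  exists_lt : 0 < α → ∃ x, χ x < ((1 / α : ℝ) : EReal)

lemma IsBase.baseInf_lt {χ : E n → EReal} (h : IsBase α χ) (x : E n) : baseInf α < χ x := by
  obtain ⟨c, hc, hcx⟩ := h.lower
  exact hc.trans_le (hcx x)

lemma IsBase.ne_bot {χ : E n → EReal} (h : IsBase α χ) (x : E n) : χ x ≠ ⊥ :=
  (bot_le.trans_lt (h.baseInf_lt x)).ne'

/-- Information can be lost only where `profile` vanishes. For α > 0 such points of the domain carry
the value 1/α, and a segment to a point with smaller value shows that they lie in the closure of the
support; a closed domain excludes all others from this closure. -/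
lemma IsBase.baseFn_ofBase {χ : E n → EReal} (h : IsBase α χ) : baseFn α (ofBase α χ) = χ := by
  funext x
  have hlo := h.baseInf_lt x
  rcases lt_or_ge (χ x) (baseSup α) with hx | hx
  · obtain ⟨p, hp⟩ := exists_coe_of_lt hlo hx
    rw [baseFn_of_pos (by rw [ofBase_apply]; exact profile_pos hlo hx), ofBase_apply, hp]
    rw [hp] at hlo hx
    rw [level_profile hlo hx]
  · have h0 : ofBase α χ x = 0 := by rw [ofBase_apply]; exact profile_eq_zero hx
    rcases le_or_gt α 0 with hα | hα
    · rw [baseFn_of_eq_zero h0 hα]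
      rw [baseSup_of_nonpos hα, top_le_iff] at hx
      exact hx.symm
    · have hsupp : Function.support (ofBase α χ) ⊆ {x | χ x ≠ ⊤} := by
        intro z hz
        rw [Function.mem_support, ofBase_apply, profile_ne_zero_iff (h.baseInf_lt z)] at hz
        exact ne_top_of_lt_baseSup hz
      by_cases hxt : χ x = ⊤
      · rw [hxt]
        refine baseFn_of_notMem_closure hα fun hcl => ?_
        exact closure_minimal hsupp (h.compact_dom hα).isClosed hcl hxt
      · have hxe : χ x = ((1 / α : ℝ) : EReal) :=
          le_antisymm (h.upper hα x hxt) (baseSup_of_pos hα ▸ hx)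
        rw [hxe]
        refine baseFn_of_mem_closure h0 hα ?_
        obtain ⟨z, hz⟩ := h.exists_lt hα
        obtain ⟨p, hp⟩ := exists_coe_of_ne (h.ne_bot z) (hz.trans (EReal.coe_lt_top _)).ne
        rw [hp, EReal.coe_lt_coe_iff] at hz
        have hlim : Tendsto (fun t : ℝ => (1 - t) • x + t • z) (𝓝[>] 0) (𝓝 x) := by
          have : Tendsto (fun t : ℝ => (1 - t) • x + t • z) (𝓝 0)
              (𝓝 ((1 - (0 : ℝ)) • x + (0 : ℝ) • z)) :=
            (by fun_prop : Continuous fun t : ℝ => (1 - t) • x + t • z).tendsto 0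
          rw [sub_zero, one_smul, zero_smul, add_zero] at this
          exact this.mono_left nhdsWithin_le_nhds
        refine mem_closure_of_tendsto hlim ?_
        filter_upwards [Ioo_mem_nhdsGT (zero_lt_one (α := ℝ))] with t ht
        rw [Function.mem_support, ofBase_apply, profile_ne_zero_iff (h.baseInf_lt _),
          baseSup_of_pos hα]
        refine (convex_epigraph_le h.convex hxe.le hp.le (sub_nonneg.2 ht.2.le) ht.1.le
          (by ring)).trans_lt (EReal.coe_lt_coe_iff.2 ?_)
        nlinarith [mul_lt_mul_of_pos_left hz ht.1]

lemma IsBase.reflectFun {χ : E n → EReal} (h : IsBase α χ) {u : E n} (hu : ‖u‖ = 1) :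
    IsBase α (reflectFun u χ) where
  convex := by
    refine convex_epigraph_of fun a b p q s t ha hb hs ht hst => ?_
    have := convex_epigraph_le h.convex (a := reflect u a) (b := reflect u b) ha.le hb.le hs ht hst
    rwa [← reflect_smul, ← reflect_smul, ← reflect_add] at this
  lower := by
    obtain ⟨c, hc, hcx⟩ := h.lower
    exact ⟨c, hc, fun x => hcx _⟩
  compact_dom hα := by
    have : {x | MinkSymm.reflectFun u χ x ≠ ⊤} = reflect u '' {x | χ x ≠ ⊤} := by
      ext x
      constructor
      · intro hx
        exact ⟨reflect u x, hx, reflect_reflect hu x⟩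
      · rintro ⟨y, hy, rfl⟩
        change χ (reflect u (reflect u y)) ≠ ⊤
        rwa [reflect_reflect hu]
    rw [this]
    exact (h.compact_dom hα).image (continuous_reflect u)
  upper hα x hx := h.upper hα _ hx
  exists_lt hα := by
    obtain ⟨x, hx⟩ := h.exists_lt hα
    refine ⟨reflect u x, ?_⟩
    change χ (reflect u (reflect u x)) < _
    rwa [reflect_reflect hu]

lemma epiMul_half_apply (χ : E n → EReal) (x : E n) :
    epiMul (1 / 2) χ x = ((1 / 2 : ℝ) : EReal) * χ ((2 : ℝ) • x) := by
  simp [epiMul]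

lemma half_mul_eq_top_iff {a : EReal} : ((1 / 2 : ℝ) : EReal) * a = ⊤ ↔ a = ⊤ := by
  induction a with
  | bot => rw [half_mul_bot]
  | top => rw [half_mul_top]
  | coe a => rw [half_mul_coe]; simp only [EReal.coe_ne_top]

lemma baseInf_lt_half {c : ℝ} (h : baseInf α < c) : baseInf α < ((c / 2 : ℝ) : EReal) := by
  unfold baseInf at *
  split_ifs at * with hα
  · rw [EReal.coe_lt_coe_iff] at *
    have : 1 / α < 0 := one_div_neg.2 hα
    linarith
  · exact EReal.bot_lt_coe _

lemma IsBase.epiMul_half {χ : E n → EReal} (h : IsBase α χ) : IsBase α (epiMul (1 / 2) χ) where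
  convex := by
    have key : ∀ (a : E n) (p : ℝ), epiMul (1 / 2) χ a < p → χ ((2 : ℝ) • a) ≤ ((2 * p : ℝ) : EReal) := by
      intro a p ha
      rw [epiMul_half_apply] at ha
      have hat : χ ((2 : ℝ) • a) ≠ ⊤ := fun h0 => by
        rw [h0, half_mul_top] at ha
        exact not_top_lt ha
      obtain ⟨r, hr⟩ := exists_coe_of_ne (h.ne_bot _) hat
      rw [hr, half_mul_coe, EReal.coe_lt_coe_iff] at ha
      rw [hr, EReal.coe_le_coe_iff]
      linarith
    refine convex_epigraph_of fun a b p q s t ha hb hs ht hst => ?_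
    have := half_mul_mono (convex_epigraph_le h.convex (key a p ha) (key b q hb) hs ht hst)
    rw [half_mul_coe] at this
    rw [epiMul_half_apply, show (2 : ℝ) • (s • a + t • b) = s • (2 : ℝ) • a + t • (2 : ℝ) • b by module]
    refine this.trans (EReal.coe_le_coe_iff.2 (le_of_eq ?_))
    ring
  lower := by
    obtain ⟨c, hc, hcx⟩ := h.lower
    refine ⟨c / 2, baseInf_lt_half hc, fun x => ?_⟩
    rw [epiMul_half_apply, ← half_mul_coe]
    exact half_mul_mono (hcx _)
  compact_dom hα := by
    have : {x | epiMul (1 / 2) χ x ≠ ⊤} = (fun y : E n => (1 / 2 : ℝ) • y) '' {x | χ x ≠ ⊤} := by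
      ext x
      rw [Set.mem_ofPred_eq, epiMul_half_apply, Ne, half_mul_eq_top_iff]
      constructor
      · intro hx
        exact ⟨(2 : ℝ) • x, hx, by simp [smul_smul]⟩
      · rintro ⟨y, hy, rfl⟩
        simpa [smul_smul] using hy
    rw [this]
    exact (h.compact_dom hα).image (by fun_prop)
  upper hα x hx := by
    rw [epiMul_half_apply, Ne, half_mul_eq_top_iff] at hx
    have h1 := half_mul_mono (h.upper hα _ hx)
    rw [half_mul_coe] at h1
    rw [epiMul_half_apply]
    refine h1.trans (EReal.coe_le_coe_iff.2 (half_le_self (by positivity)))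
  exists_lt hα := by
    obtain ⟨x, hx⟩ := h.exists_lt hα
    refine ⟨(1 / 2 : ℝ) • x, ?_⟩
    have h1 := half_mul_mono hx.le
    rw [half_mul_coe] at h1
    rw [epiMul_half_apply, smul_smul, show (2 : ℝ) * (1 / 2) = 1 by norm_num, one_smul]
    exact h1.trans_lt (EReal.coe_lt_coe_iff.2 (half_lt_self (by positivity)))

/-- The new domain is half the Minkowski sum of the old domain and its reflection. Compactness
passes to such sums, whereas closedness alone need not. -/
lemma IsBase.symmetral {χ : E n → EReal} (h : IsBase α χ) {u : E n} (hu : ‖u‖ = 1) :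
    IsBase α (symmetral u χ) where
  convex := convex_symmetral hu h.ne_bot h.convex
  lower := by
    obtain ⟨c, hc, hcx⟩ := h.lower
    exact ⟨c, hc, le_symmetral hu hcx⟩
  compact_dom hα := by
    have : {x | MinkSymm.symmetral u χ x ≠ ⊤} =
        (fun p : E n × E n => (1 / 2 : ℝ) • (p.1 + reflect u p.2)) ''
          ({x | χ x ≠ ⊤} ×ˢ {x | χ x ≠ ⊤}) := by
      ext x
      constructor
      · intro hx
        obtain ⟨a, b, p, q, ha, hb, rfl, -⟩ :=
          exists_of_symmetral_lt hu h.ne_bot (lt_top_iff_ne_top.2 hx)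
        exact ⟨(a, b), ⟨by simp [ha], by simp [hb]⟩, rfl⟩
      · rintro ⟨⟨a, b⟩, ⟨ha, hb⟩, rfl⟩
        obtain ⟨p, hp⟩ := exists_coe_of_ne (h.ne_bot a) ha
        obtain ⟨q, hq⟩ := exists_coe_of_ne (h.ne_bot b) hb
        exact ((symmetral_le hu hp.le hq.le).trans_lt (EReal.coe_lt_top _)).ne
    rw [this]
    refine ((h.compact_dom hα).prod (h.compact_dom hα)).image ?_
    have := continuous_reflect u
    fun_prop
  upper hα x hx := by
    obtain ⟨a, b, p, q, ha, hb, rfl, -⟩ :=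
      exists_of_symmetral_lt hu h.ne_bot (lt_top_iff_ne_top.2 hx)
    have h1 := symmetral_le hu (h.upper hα a (by simp [ha])) (h.upper hα b (by simp [hb]))
    rwa [add_self_div_two] at h1
  exists_lt hα := by
    obtain ⟨x, hx⟩ := h.exists_lt hα
    obtain ⟨p, hp⟩ := exists_coe_of_ne (h.ne_bot x) (hx.trans (EReal.coe_lt_top _)).ne
    refine ⟨_, (symmetral_le hu hp.le hp.le).trans_lt ?_⟩
    rwa [add_self_div_two, ← hp]

lemma IsBase.iterSymmetral {χ : E n → EReal} (h : IsBase α χ) {u : ℕ → E n}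
    (hu : ∀ i, ‖u i‖ = 1) (m : ℕ) : IsBase α (iterSymmetral u χ m) := by
  induction m with
  | zero => exact h
  | succ m ih => exact ih.symmetral (hu m)

/-- The homotheties and the Asplund sum repeatedly pass to functions and back to bases; every such
round trip cancels because `IsBase` is stable under reflection and epi-multiplication by 1/2. -/
lemma IsBase.alphaSymmetral_ofBase {χ : E n → EReal} (h : IsBase α χ) {u : E n} (hu : ‖u‖ = 1) :
    alphaSymmetral α u (ofBase α χ) = ofBase α (MinkSymm.symmetral u χ) := by
  have h1 : MinkSymm.reflectFun u (ofBase α χ) = ofBase α (MinkSymm.reflectFun u χ) := rfl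
  rw [alphaSymmetral, asplund, homothety, homothety, h1, h.baseFn_ofBase,
    (h.reflectFun hu).baseFn_ofBase, h.epiMul_half.baseFn_ofBase,
    (h.reflectFun hu).epiMul_half.baseFn_ofBase, MinkSymm.symmetral]

lemma IsBase.iterAlphaSymmetral_ofBase {χ : E n → EReal} (h : IsBase α χ) {u : ℕ → E n}
    (hu : ∀ i, ‖u i‖ = 1) (m : ℕ) :
    iterAlphaSymmetral α u (ofBase α χ) m = ofBase α (MinkSymm.iterSymmetral u χ m) := by
  induction m with
  | zero => rfl
  | succ m ih =>
    rw [iterAlphaSymmetral, ih, (h.iterSymmetral hu m).alphaSymmetral_ofBase (hu m),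
      MinkSymm.iterSymmetral]

/-! ### Base functions of members of `C_α` -/

lemma IsAlphaClass.pos_of_ne {f : E n → ℝ} (h : IsAlphaClass α f) {x : E n} (hx : f x ≠ 0) :
    0 < f x := (h.nonneg x).lt_of_ne hx.symm

lemma IsAlphaClass.ofBase_baseFn {f : E n → ℝ} (h : IsAlphaClass α f) :
    ofBase α (baseFn α f) = f := by
  funext x
  rw [ofBase_apply]
  by_cases hx : f x = 0
  · rw [hx]
    rcases le_or_gt α 0 with hα | hα
    · rw [baseFn_of_eq_zero hx hα, profile_top]
    · by_cases hcl : x ∈ closure (Function.support f)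
      · rw [baseFn_of_mem_closure hx hα hcl]
        exact profile_eq_zero (baseSup_of_pos hα).le
      · rw [baseFn_of_notMem_closure hα hcl, profile_top]
  · rw [baseFn_of_pos (h.pos_of_ne hx), profile_level (h.pos_of_ne hx)]

lemma IsAlphaClass.baseInf_lt {f : E n → ℝ} (h : IsAlphaClass α f) (x : E n) :
    baseInf α < baseFn α f x := by
  by_cases hx : f x = 0
  · rcases le_or_gt α 0 with hα | hα
    · rw [baseFn_of_eq_zero hx hα, baseInf]
      split_ifs
      · exact EReal.coe_lt_top _
      · exact bot_lt_top
    · rw [baseInf, if_neg hα.not_gt, bot_lt_iff_ne_bot]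
      by_cases hcl : x ∈ closure (Function.support f)
      · rw [baseFn_of_mem_closure hx hα hcl]
        exact EReal.coe_ne_bot _
      · rw [baseFn_of_notMem_closure hα hcl]
        exact top_ne_bot
  · rw [baseFn_of_pos (h.pos_of_ne hx)]
    exact baseInf_lt_level (h.pos_of_ne hx)

lemma IsAlphaClass.baseFn_le_iff {f : E n → ℝ} (h : IsAlphaClass α f) {τ : ℝ} (h1 : baseInf α < τ)
    (h2 : (τ : EReal) < baseSup α) (x : E n) : baseFn α f x ≤ τ ↔ profile α τ ≤ f x := by
  by_cases hx : f x = 0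
  · have h3 : ¬ profile α τ ≤ f x := by
      rw [hx, not_le]
      exact profile_pos h1 h2
    refine iff_of_false (fun hle => ?_) h3
    rcases le_or_gt α 0 with hα | hα
    · rw [baseFn_of_eq_zero hx hα, top_le_iff] at hle
      exact EReal.coe_ne_top _ hle
    · by_cases hcl : x ∈ closure (Function.support f)
      · rw [baseFn_of_mem_closure hx hα hcl, ← baseSup_of_pos hα] at hle
        exact hle.not_gt h2
      · rw [baseFn_of_notMem_closure hα hcl, top_le_iff] at hle
        exact EReal.coe_ne_top _ hle
  · rw [baseFn_of_pos (h.pos_of_ne hx), EReal.coe_le_coe_iff, level_le_iff (h.pos_of_ne hx) h1]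

lemma IsAlphaClass.baseFn_ne_top_iff {f : E n → ℝ} (h : IsAlphaClass α f) (hα : 0 < α) (x : E n) :
    baseFn α f x ≠ ⊤ ↔ x ∈ closure (Function.support f) := by
  constructor
  · intro hx
    by_contra hcl
    exact hx (baseFn_of_notMem_closure hα hcl)
  · intro hcl
    by_cases hx : f x = 0
    · rw [baseFn_of_mem_closure hx hα hcl]
      exact EReal.coe_ne_top _
    · rw [baseFn_of_pos (h.pos_of_ne hx)]
      exact EReal.coe_ne_top _

lemma IsAlphaClass.baseFn_le_of_mem_closure {f : E n → ℝ} (h : IsAlphaClass α f) (hα : 0 < α)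
    {x : E n} (hcl : x ∈ closure (Function.support f)) :
    baseFn α f x ≤ ((1 / α : ℝ) : EReal) := by
  by_cases hx : f x = 0
  · rw [baseFn_of_mem_closure hx hα hcl]
  · rw [baseFn_of_pos (h.pos_of_ne hx), ← baseSup_of_pos hα]
    exact (level_lt_baseSup (h.pos_of_ne hx)).le

/-- On the support, base functions are convex. -/
lemma IsAlphaClass.baseFn_le_of_support {f : E n → ℝ} (h : IsAlphaClass α f) {a b : E n}
    (ha : f a ≠ 0) (hb : f b ≠ 0) {s t : ℝ} (hs : 0 ≤ s) (ht : 0 ≤ t) (hst : s + t = 1) :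
    baseFn α f (s • a + t • b) ≤ ((s * level α (f a) + t * level α (f b) : ℝ) : EReal) := by
  have ha' := h.pos_of_ne ha
  have hb' := h.pos_of_ne hb
  have h1 := baseInf_lt_level (α := α) ha'
  have h2 := baseInf_lt_level (α := α) hb'
  have h3 := level_lt_baseSup (α := α) ha'
  have h4 := level_lt_baseSup (α := α) hb'
  obtain ⟨h5, h6⟩ := convex_comb_mem h1 h2 h3 h4 hs ht hst
  rw [h.baseFn_le_iff h5 h6, ← alphaMean_profile h1 h2 h3 h4 hs ht hst, profile_level ha',
    profile_level hb']
  have e : t = 1 - s := by linarith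
  subst e
  exact h.concave.2 a ha b hb s ⟨hs, by linarith⟩

/-- The midpoint of x₀ and any y in the support has base value at most a fixed τ < 1/α, hence lies
in a bounded superlevel set K of f; so the support lies in 2K - x₀. -/
lemma IsAlphaClass.isCompact_closure_support {f : E n → ℝ} (h : IsAlphaClass α f) (hα : 0 < α) :
    IsCompact (closure (Function.support f)) := by
  obtain ⟨x₀, hx₀⟩ := h.proper
  have hx₀' := h.pos_of_ne hx₀
  set τ := 1 / 2 * level α (f x₀) + 1 / 2 * (1 / α) with hτ
  have h1 : baseInf α < τ := by
    rw [baseInf, if_neg hα.not_gt]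
    exact EReal.bot_lt_coe _
  have h0 := level_lt_baseSup (α := α) hx₀'
  rw [baseSup_of_pos hα, EReal.coe_lt_coe_iff] at h0
  have h2 : (τ : EReal) < baseSup α := by
    rw [baseSup_of_pos hα, EReal.coe_lt_coe_iff]
    linarith
  have hev : ∀ᶠ x in cocompact (E n), f x < profile α τ :=
    h.vanish.eventually (gt_mem_nhds (profile_pos h1 h2))
  obtain ⟨K, hK, hKs⟩ := mem_cocompact.1 hev
  refine Bornology.IsBounded.isCompact_closure
    ((hK.image (by fun_prop : Continuous fun x : E n => (2 : ℝ) • x - x₀)).isBounded.subset ?_)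
  intro y hy
  have hle := h.baseFn_le_of_support hx₀ hy (s := 1 / 2) (t := 1 / 2) (by norm_num) (by norm_num)
    (by norm_num)
  have hly := level_lt_baseSup (α := α) (h.pos_of_ne hy)
  rw [baseSup_of_pos hα, EReal.coe_lt_coe_iff] at hly
  have hle' := hle.trans (EReal.coe_le_coe_iff.2 (show _ ≤ τ by rw [hτ]; linarith))
  rw [h.baseFn_le_iff h1 h2] at hle'
  refine ⟨(1 / 2 : ℝ) • x₀ + (1 / 2 : ℝ) • y, ?_, ?_⟩
  · by_contra hn
    exact (hKs hn : f _ < _).not_ge hle'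
  · module

/-- Sublevel sets are empty, superlevel sets of f, the closure of the support (when α > 0), or the
whole space. -/
lemma IsAlphaClass.lowerSemicontinuous_baseFn {f : E n → ℝ} (h : IsAlphaClass α f) :
    LowerSemicontinuous (baseFn α f) := by
  rw [lowerSemicontinuous_iff_isClosed_preimage]
  intro y
  induction y with
  | bot =>
    have : baseFn α f ⁻¹' Set.Iic ⊥ = ∅ := by
      ext x
      simpa using (bot_le.trans_lt (h.baseInf_lt x)).ne'
    rw [this]
    exact isClosed_empty
  | top => simp
  | coe τ =>
    rcases le_or_gt (τ : EReal) (baseInf α) with h1 | h1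
    · have : baseFn α f ⁻¹' Set.Iic (τ : EReal) = ∅ := by
        ext x
        simpa using h1.trans_lt (h.baseInf_lt x)
      rw [this]
      exact isClosed_empty
    rcases lt_or_ge (τ : EReal) (baseSup α) with h2 | h2
    · have : baseFn α f ⁻¹' Set.Iic (τ : EReal) = f ⁻¹' Set.Ici (profile α τ) := by
        ext x
        exact h.baseFn_le_iff h1 h2 x
      rw [this]
      exact h.usc.isClosed_preimage _
    · rcases le_or_gt α 0 with hα | hα
      · rw [baseSup_of_nonpos hα, top_le_iff] at h2
        exact absurd h2 (EReal.coe_ne_top _)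
      have : baseFn α f ⁻¹' Set.Iic (τ : EReal) = closure (Function.support f) := by
        ext x
        rw [Set.mem_preimage, Set.mem_Iic, ← h.baseFn_ne_top_iff hα]
        constructor
        · intro hx
          exact (hx.trans_lt (EReal.coe_lt_top _)).ne
        · intro hx
          rw [baseSup_of_pos hα] at h2
          exact (h.baseFn_le_of_mem_closure hα ((h.baseFn_ne_top_iff hα x).1 hx)).trans h2
      rw [this]
      exact isClosed_closure

lemma IsAlphaClass.baseFn_le_of_closure {f : E n → ℝ} (h : IsAlphaClass α f) (hα : 0 < α)
    {a b : E n} (ha : f a ≠ 0) (hb : b ∈ closure (Function.support f)) {s t : ℝ} (hs : 0 ≤ s)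
    (ht : 0 ≤ t) (hst : s + t = 1) :
    baseFn α f (s • a + t • b) ≤ ((s * level α (f a) + t * (1 / α) : ℝ) : EReal) := by
  have hclosed : IsClosed {b : E n | baseFn α f (s • a + t • b) ≤
      ((s * level α (f a) + t * (1 / α) : ℝ) : EReal)} :=
    (h.lowerSemicontinuous_baseFn.isClosed_preimage
      ((s * level α (f a) + t * (1 / α) : ℝ) : EReal)).preimage
      (by fun_prop : Continuous fun b : E n => s • a + t • b)
  refine closure_minimal (fun y hy => ?_) hclosed hb
  refine (h.baseFn_le_of_support ha hy hs ht hst).trans (EReal.coe_le_coe_iff.2 ?_)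
  have hly := level_lt_baseSup (α := α) (h.pos_of_ne hy)
  rw [baseSup_of_pos hα, EReal.coe_lt_coe_iff] at hly
  have := mul_le_mul_of_nonneg_left hly.le ht
  linarith

lemma IsAlphaClass.convex_baseFn {f : E n → ℝ} (h : IsAlphaClass α f) :
    Convex ℝ {p : E n × ℝ | baseFn α f p.1 ≤ (p.2 : EReal)} := by
  refine convex_epigraph_of fun a b p q s t ha hb hs ht hst => ?_
  have hat := (ha.trans (EReal.coe_lt_top _)).ne
  have hbt := (hb.trans (EReal.coe_lt_top _)).ne
  have comb : ∀ x y : ℝ, x < p → y < q → s * x + t * y ≤ s * p + t * q := fun x y hx hy =>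
    add_le_add (mul_le_mul_of_nonneg_left hx.le hs) (mul_le_mul_of_nonneg_left hy.le ht)
  have lev : ∀ {x : E n} {r : ℝ}, f x ≠ 0 → baseFn α f x < r → level α (f x) < r := by
    intro x r hx hr
    rwa [baseFn_of_pos (h.pos_of_ne hx), EReal.coe_lt_coe_iff] at hr
  by_cases ha0 : f a = 0 <;> by_cases hb0 : f b = 0
  · rcases le_or_gt α 0 with hα | hα
    · exact absurd (baseFn_of_eq_zero ha0 hα) hat
    have hac := (h.baseFn_ne_top_iff hα a).1 hat
    have hbc := (h.baseFn_ne_top_iff hα b).1 hbt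
    rw [baseFn_of_mem_closure ha0 hα hac, EReal.coe_lt_coe_iff] at ha
    rw [baseFn_of_mem_closure hb0 hα hbc, EReal.coe_lt_coe_iff] at hb
    refine (h.baseFn_le_of_mem_closure hα (h.concave.1.closure hac hbc hs ht hst)).trans
      (EReal.coe_le_coe_iff.2 (le_trans (le_of_eq ?_) (comb _ _ ha hb)))
    rw [← add_mul, hst, one_mul]
  · rcases le_or_gt α 0 with hα | hα
    · exact absurd (baseFn_of_eq_zero ha0 hα) hat
    have hac := (h.baseFn_ne_top_iff hα a).1 hat
    rw [baseFn_of_mem_closure ha0 hα hac, EReal.coe_lt_coe_iff] at ha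
    rw [add_comm]
    refine (h.baseFn_le_of_closure hα hb0 hac ht hs (by linarith)).trans
      (EReal.coe_le_coe_iff.2 ?_)
    linarith [comb _ _ ha (lev hb0 hb)]
  · rcases le_or_gt α 0 with hα | hα
    · exact absurd (baseFn_of_eq_zero hb0 hα) hbt
    have hbc := (h.baseFn_ne_top_iff hα b).1 hbt
    rw [baseFn_of_mem_closure hb0 hα hbc, EReal.coe_lt_coe_iff] at hb
    exact (h.baseFn_le_of_closure hα ha0 hbc hs ht hst).trans
      (EReal.coe_le_coe_iff.2 (comb _ _ (lev ha0 ha) hb))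
  · exact (h.baseFn_le_of_support ha0 hb0 hs ht hst).trans
      (EReal.coe_le_coe_iff.2 (comb _ _ (lev ha0 ha) (lev hb0 hb)))

lemma IsAlphaClass.isConvC_baseFn {f : E n → ℝ} (h : IsAlphaClass α f) :
    IsConvC (baseFn α f) where
  convex := h.convex_baseFn
  ne_bot x := (bot_le.trans_lt (h.baseInf_lt x)).ne'
  dom_nonempty := by
    obtain ⟨x, hx⟩ := h.proper
    refine ⟨x, ?_⟩
    rw [baseFn_of_pos (h.pos_of_ne hx)]
    exact EReal.coe_ne_top _
  lsc := h.lowerSemicontinuous_baseFn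
  coercive := by
    rw [EReal.tendsto_nhds_top_iff_real]
    intro τ
    rcases le_or_gt (τ : EReal) (baseInf α) with h1 | h1
    · exact Eventually.of_forall fun x => h1.trans_lt (h.baseInf_lt x)
    rcases lt_or_ge (τ : EReal) (baseSup α) with h2 | h2
    · filter_upwards [h.vanish.eventually (gt_mem_nhds (profile_pos h1 h2))] with x hx
      rw [← not_le, h.baseFn_le_iff h1 h2]
      exact not_le.2 hx
    · rcases le_or_gt α 0 with hα | hα
      · rw [baseSup_of_nonpos hα, top_le_iff] at h2
        exact absurd h2 (EReal.coe_ne_top _)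
      filter_upwards [(h.isCompact_closure_support hα).compl_mem_cocompact] with x hx
      rw [baseFn_of_notMem_closure hα hx]
      exact EReal.coe_lt_top _

lemma IsAlphaClass.isBase_baseFn {f : E n → ℝ} (h : IsAlphaClass α f) : IsBase α (baseFn α f) where
  convex := h.convex_baseFn
  lower := by
    obtain ⟨x₀, hx₀⟩ := h.isConvC_baseFn.exists_min
    obtain ⟨x₁, hx₁⟩ := h.isConvC_baseFn.dom_nonempty
    obtain ⟨c, hc⟩ := exists_coe_of_ne (h.isConvC_baseFn.ne_bot x₀)
      ((hx₀ x₁).trans_lt (lt_top_iff_ne_top.2 hx₁)).ne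
    exact ⟨c, hc ▸ h.baseInf_lt x₀, fun x => hc ▸ hx₀ x⟩
  compact_dom hα := by
    have : {x | baseFn α f x ≠ ⊤} = closure (Function.support f) :=
      Set.ext fun x => h.baseFn_ne_top_iff hα x
    rw [this]
    exact h.isCompact_closure_support hα
  upper hα x hx := h.baseFn_le_of_mem_closure hα ((h.baseFn_ne_top_iff hα x).1 hx)
  exists_lt hα := by
    obtain ⟨x, hx⟩ := h.proper
    refine ⟨x, ?_⟩
    rw [baseFn_of_pos (h.pos_of_ne hx), ← baseSup_of_pos hα]
    exact level_lt_baseSup (h.pos_of_ne hx)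

/-- For α = 0 the exponential loses nothing and no domain condition is imposed, which is why
lower-dimensional supports are allowed in LC_c. -/
lemma IsConvC.isBase_zero {ψ : E n → EReal} (h : IsConvC ψ) : IsBase 0 ψ where
  convex := h.convex
  lower := by
    obtain ⟨c, hc⟩ := h.isBddConvex.bddBelow
    exact ⟨c, by simp [baseInf], hc⟩
  compact_dom h0 := absurd h0 (lt_irrefl 0)
  upper h0 := absurd h0 (lt_irrefl 0)
  exists_lt h0 := absurd h0 (lt_irrefl 0)

end BaseFunctions

/-! ### Hypo-convergence and membership in C_α -/

section HypoSymmetrization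

variable {n : ℕ} {α : ℝ}

lemma EpiConverges.le_of_forall_le {ψs : ℕ → E n → EReal} {φ : E n → EReal}
    (h : EpiConverges ψs φ) {c : EReal} (hc : ∀ m x, c ≤ ψs m x) (x : E n) : c ≤ φ x := by
  obtain ⟨xs, -, hlim⟩ := (h x).2
  exact ge_of_tendsto' hlim fun m => hc m _

/-- Bounded sequences at which epi-convergent functions are at most `c` produce a limit point at
which the limit is at most `c`. -/
lemma EpiConverges.exists_le {ψs : ℕ → E n → EReal} {φ : E n → EReal} (h : EpiConverges ψs φ)
    {ps : ℕ → E n} {r R : ℝ} {c : EReal} (hr : ∀ m, r ≤ ‖ps m‖) (hR : ∀ m, ‖ps m‖ ≤ R)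
    (hc : ∀ m, ψs m (ps m) ≤ c) : ∃ p, r ≤ ‖p‖ ∧ φ p ≤ c := by
  classical
  obtain ⟨p, -, k, hk, hlim⟩ := (isCompact_closedBall (0 : E n) R).tendsto_subseq
    (x := ps) (fun m => by simpa using hR m)
  refine ⟨p, ge_of_tendsto' hlim.norm fun j => hr _, ?_⟩
  -- Epi-convergence speaks of full sequences, so the gaps of the subsequence are filled with its
  -- limit p.
  set xs : ℕ → E n := fun m => if m ∈ Set.range k then ps m else p with hxs
  have hxs_lim : Tendsto xs atTop (𝓝 p) := by
    rw [Metric.tendsto_atTop] at hlim ⊢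
    intro ε hε
    obtain ⟨J, hJ⟩ := hlim ε hε
    refine ⟨k J, fun m hm => ?_⟩
    by_cases hmk : m ∈ Set.range k
    · obtain ⟨j, rfl⟩ := hmk
      simp only [hxs, Set.mem_range_self, if_true]
      exact hJ j (hk.le_iff_le.1 hm)
    · simp only [hxs, hmk, if_false, dist_self]
      exact hε
  refine ((h p).1 xs hxs_lim).trans ?_
  refine liminf_le_of_frequently_le' ?_
  rw [frequently_atTop]
  intro M
  refine ⟨k M, hk.le_apply, ?_⟩
  simp only [hxs, Set.mem_range_self, if_true]
  exact hc _

/-- A ball on which a function is at most `c` persists under symmetrization. -/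
lemma exists_ball_le_iterSymmetral {ψ : E n → EReal} {u : ℕ → E n} (hu : ∀ i, ‖u i‖ = 1)
    {x₀ : E n} {r c : ℝ} (h : ∀ x, ‖x - x₀‖ ≤ r → ψ x ≤ c) (m : ℕ) :
    ∃ y : E n, ‖y‖ ≤ ‖x₀‖ ∧ ∀ x, ‖x - y‖ ≤ r → iterSymmetral u ψ m x ≤ c := by
  induction m with
  | zero => exact ⟨x₀, le_rfl, h⟩
  | succ m ih =>
    obtain ⟨y, hy, hyc⟩ := ih
    refine ⟨(1 / 2 : ℝ) • (y + reflect (u m) y), ?_, fun x hx => ?_⟩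
    · rw [norm_smul, Real.norm_of_nonneg (by norm_num)]
      have := norm_add_le y (reflect (u m) y)
      rw [norm_reflect (hu m)] at this
      linarith
    -- Both halves use the same displacement: the average of y + d and R(y + Rd) is the new centre
    -- plus d. Hence the radius does not shrink.
    · set d := x - (1 / 2 : ℝ) • (y + reflect (u m) y) with hd
      have h1 := symmetral_le (hu m) (hyc (y + d) (by rwa [add_sub_cancel_left]))
        (hyc (y + reflect (u m) d) (by rwa [add_sub_cancel_left, norm_reflect (hu m)]))
      have e : (1 / 2 : ℝ) • (y + d + reflect (u m) (y + reflect (u m) d)) = x := by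
        rw [reflect_add, reflect_reflect (hu m), hd]
        module
      rwa [e, add_self_div_two] at h1

/-- Finitely many points of the support span the space affinely, and the largest base value among
them is below the vanishing level. The sublevel set at that value is convex and spanning, so it has
interior. -/
lemma IsAlphaClass.exists_ball {f : E n → ℝ} (h : IsAlphaClass α f) :
    ∃ (x₀ : E n) (r c : ℝ), 0 < r ∧ (c : EReal) < baseSup α ∧
      ∀ x, ‖x - x₀‖ ≤ r → baseFn α f x ≤ c := by
  obtain ⟨t, hts, htspan, hind⟩ := exists_affineIndependent ℝ (E n) (Function.support f)
  rw [h.full_dim] at htspan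
  have htf : t.Finite := finite_set_of_fin_dim_affineIndependent ℝ hind
  have htne : t.Nonempty := by
    rw [Set.nonempty_iff_ne_empty]
    rintro rfl
    rw [AffineSubspace.span_empty] at htspan
    exact AffineSubspace.bot_ne_top ℝ (E n) (E n) htspan
  obtain ⟨a, ha, hmax⟩ := Set.exists_max_image t (fun x => level α (f x)) htf htne
  set c := level α (f a) with hc
  have hconv : Convex ℝ {x | baseFn α f x ≤ (c : EReal)} := by
    intro x hx y hy s t hs ht hst
    have := convex_epigraph_le h.convex_baseFn hx hy hs ht hst
    rwa [← add_mul, hst, one_mul] at this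
  have hsub : t ⊆ {x | baseFn α f x ≤ (c : EReal)} := by
    intro x hx
    rw [Set.mem_ofPred_eq, baseFn_of_pos (h.pos_of_ne (hts hx)), EReal.coe_le_coe_iff]
    exact hmax x hx
  have hspan : affineSpan ℝ {x | baseFn α f x ≤ (c : EReal)} = ⊤ :=
    top_le_iff.1 (htspan ▸ affineSpan_mono ℝ hsub)
  obtain ⟨x₀, hx₀⟩ := hconv.interior_nonempty_iff_affineSpan_eq_top.2 hspan
  obtain ⟨r, hr, hball⟩ := Metric.nhds_basis_closedBall.mem_iff.1 (mem_interior_iff_mem_nhds.1 hx₀)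
  refine ⟨x₀, r, c, hr, level_lt_baseSup (h.pos_of_ne (hts ha)), fun x hx => hball ?_⟩
  rwa [Metric.mem_closedBall, dist_eq_norm]

/-- A nontrivial rotation-invariant convex set spans. -/
lemma affineSpan_eq_top_of_rotation {S : Set (E n)} (hS : Convex ℝ S)
    (hrot : ∀ (T : E n ≃ₗᵢ[ℝ] E n), ∀ x ∈ S, T x ∈ S) {p : E n} (hp : p ∈ S) (hp0 : p ≠ 0) :
    affineSpan ℝ S = ⊤ := by
  have hp' : 0 < ‖p‖ := norm_pos_iff.2 hp0
  have hsphere : ∀ q, ‖q‖ = ‖p‖ → q ∈ S := by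
    intro q hq
    -- The reflection in the bisecting hyperplane of p and q sends p to q.
    have := hrot ((Submodule.span ℝ {p - q})ᗮ.reflection) p hp
    rwa [Submodule.reflection_sub hq.symm] at this
  have hzero : (0 : E n) ∈ S := by
    have := hS hp (hsphere (-p) (norm_neg p)) (by norm_num : (0 : ℝ) ≤ 1 / 2)
      (by norm_num : (0 : ℝ) ≤ 1 / 2) (by norm_num)
    rwa [smul_neg, add_neg_cancel] at this
  rw [← hS.interior_nonempty_iff_affineSpan_eq_top]
  refine ⟨0, mem_interior_iff_mem_nhds.2 (Filter.mem_of_superset (Metric.ball_mem_nhds 0 hp') ?_)⟩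
  intro y hy
  rw [mem_ball_zero_iff] at hy
  rcases eq_or_ne y 0 with rfl | hy0
  · exact hzero
  have hyn : 0 < ‖y‖ := norm_pos_iff.2 hy0
  have hq := hsphere ((‖p‖ / ‖y‖) • y) (by
    rw [norm_smul, Real.norm_of_nonneg (by positivity), div_mul_cancel₀ _ hyn.ne'])
  have h1 : ‖y‖ / ‖p‖ ≤ 1 := (div_le_one hp').2 hy.le
  have := hS hq hzero (by positivity : 0 ≤ ‖y‖ / ‖p‖) (sub_nonneg.2 h1) (by ring)
  rw [smul_zero, add_zero, smul_smul, div_mul_div_cancel₀ hp'.ne', div_self hyn.ne',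
    one_smul] at this
  exact this

lemma support_ofBase {φ : E n → EReal} (hlo : ∀ x, baseInf α < φ x) :
    Function.support (ofBase α φ) = {x | φ x < baseSup α} := by
  ext x
  rw [Function.mem_support, ofBase_apply, profile_ne_zero_iff (hlo x), Set.mem_ofPred_eq]

/-- A coercive convex function with nontrivial effective level sets determines a member of `C_α`. -/
lemma isAlphaClass_ofBase {φ : E n → EReal} (hφ : IsConvC φ) (hlo : ∀ x, baseInf α < φ x)
    (hrot : RotationInvariant φ) {p : E n} (hp0 : p ≠ 0) (hp : φ p < baseSup α) :
    IsAlphaClass α (ofBase α φ) := by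
  have hcomb : ∀ x y, φ x < baseSup α → φ y < baseSup α → ∀ s t : ℝ, 0 ≤ s → 0 ≤ t → s + t = 1 →
      φ (s • x + t • y) < baseSup α ∧
      alphaMean α s t (ofBase α φ x) (ofBase α φ y) ≤ ofBase α φ (s • x + t • y) := by
    intro x y hx hy s t hs ht hst
    obtain ⟨a, ha⟩ := exists_coe_of_lt (hlo x) hx
    obtain ⟨b, hb⟩ := exists_coe_of_lt (hlo y) hy
    have h1 := hlo x
    have h2 := hlo y
    have hle := convex_epigraph_le hφ.convex ha.le hb.le hs ht hst
    rw [ha] at hx h1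
    rw [hb] at hy h2
    refine ⟨hle.trans_lt (convex_comb_mem h1 h2 hx hy hs ht hst).2, ?_⟩
    rw [ofBase_apply, ofBase_apply, ofBase_apply, ha, hb, alphaMean_profile h1 h2 hx hy hs ht hst]
    exact profile_anti (hlo _) hle
  have hsupp := support_ofBase hlo
  have hconv : Convex ℝ {x | φ x < baseSup α} := fun x hx y hy s t hs ht hst =>
    (hcomb x y hx hy s t hs ht hst).1
  refine ⟨fun x => profile_nonneg _, ⟨by rwa [hsupp], ?_⟩, ⟨p, ?_⟩, ?_, ?_, ?_⟩
  · rw [hsupp]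
    intro x hx y hy t ht
    exact (hcomb x y hx hy t (1 - t) ht.1 (sub_nonneg.2 ht.2) (by ring)).2
  · rwa [ofBase_apply, profile_ne_zero_iff (hlo p)]
  · intro x y hy
    obtain ⟨s, hs, hst⟩ := exists_lt_profile_lt (hlo x) hy
    filter_upwards [hφ.lsc x s hs] with z hz
    exact hst _ hz
  · rw [hsupp]
    refine affineSpan_eq_top_of_rotation hconv (fun T x hx => ?_) hp hp0
    rwa [Set.mem_ofPred_eq, hrot]
  · have htop : baseInf α < ⊤ := (hlo p).trans_le le_top
    have := (continuousAt_profile htop).tendsto.comp hφ.coercive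
    rwa [profile_top] at this

/-- Monotonicity of `profile` handles arbitrary sequences and its continuity the recovery sequence.
-/
lemma hypoConverges_ofBase {ψs : ℕ → E n → EReal} {φ : E n → EReal} (hlo : ∀ x, baseInf α < φ x)
    (h : EpiConverges ψs φ) : HypoConverges (fun m => ofBase α (ψs m)) (ofBase α φ) := by
  intro x
  refine ⟨fun xs hxs => ?_, ?_⟩
  · refine EReal.le_of_forall_lt_iff_le.1 fun z hz => ?_
    have hz' : profile α (φ x) < z := EReal.coe_lt_coe_iff.1 hz
    obtain ⟨s, hs, hst⟩ := exists_lt_profile_lt (hlo x) hz'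
    have hev := eventually_lt_of_lt_liminf (hs.trans_le ((h x).1 xs hxs))
    refine limsup_le_of_le (by isBoundedDefault) (hev.mono fun m hm => ?_)
    exact EReal.coe_le_coe_iff.2 (hst _ hm).le
  · obtain ⟨xs, hxs, hlim⟩ := (h x).2
    exact ⟨xs, hxs, (continuousAt_profile (hlo x)).tendsto.comp hlim⟩

lemma IsBase.baseInf_lt_of_epiConverges {χ φ : E n → EReal} (hχ : IsBase α χ) {u : ℕ → E n}
    (hu : ∀ i, ‖u i‖ = 1) (h : EpiConverges (MinkSymm.iterSymmetral u χ) φ) (x : E n) :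
    baseInf α < φ x := by
  obtain ⟨c, hc, hcx⟩ := hχ.lower
  exact hc.trans_le (h.le_of_forall_le (fun m => le_iterSymmetral hu hcx m) x)

lemma IsBase.hypoConverges {χ φ : E n → EReal} (hχ : IsBase α χ) {u : ℕ → E n}
    (hu : ∀ i, ‖u i‖ = 1) (h : EpiConverges (MinkSymm.iterSymmetral u χ) φ) :
    HypoConverges (iterAlphaSymmetral α u (ofBase α χ)) (ofBase α φ) := by
  have : iterAlphaSymmetral α u (ofBase α χ) =
      fun m => ofBase α (MinkSymm.iterSymmetral u χ m) :=
    funext fun m => hχ.iterAlphaSymmetral_ofBase hu m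
  rw [this]
  exact hypoConverges_ofBase (hχ.baseInf_lt_of_epiConverges hu h) h

lemma rotationInvariant_ofBase {φ : E n → EReal} (h : RotationInvariant φ) :
    RotationInvariant (ofBase α φ) := fun T x => by
  rw [ofBase_apply, ofBase_apply, h]

lemma IsAlphaClass.of_epiSymmetrization (hn : 0 < n) {f : E n → ℝ} (h : IsAlphaClass α f)
    {φ : E n → EReal} (hφ : IsEpiSymmetrization (baseFn α f) φ) : IsAlphaClass α (ofBase α φ) := by
  obtain ⟨hconv, hrot, u, hu, hepi⟩ := hφ
  obtain ⟨x₀, r, c, hr, hc, hball⟩ := h.exists_ball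
  have hps : ∀ m, ∃ p : E n, r ≤ ‖p‖ ∧ ‖p‖ ≤ ‖x₀‖ + r ∧ iterSymmetral u (baseFn α f) m p ≤ c := by
    intro m
    obtain ⟨y, hy, hyc⟩ := exists_ball_le_iterSymmetral hu hball m
    -- Going outward from the centre by r reaches a point of the ball with norm at least r, so the
    -- limit point p is nonzero and its rotations span the space.
    obtain ⟨v, hv, hvy⟩ : ∃ v : E n, ‖v‖ = 1 ∧ ‖y‖ + r ≤ ‖y + r • v‖ := by
      rcases eq_or_ne y 0 with rfl | hy0
      · obtain ⟨v, hv⟩ := exists_norm_eq_one hn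
        exact ⟨v, hv, by simp [norm_smul, hv, abs_of_pos hr]⟩
      · have hyn : 0 < ‖y‖ := norm_pos_iff.2 hy0
        refine ⟨‖y‖⁻¹ • y, by rw [norm_smul, norm_inv, norm_norm, inv_mul_cancel₀ hyn.ne'], ?_⟩
        have e : y + r • ‖y‖⁻¹ • y = (1 + r * ‖y‖⁻¹) • y := by module
        rw [e, norm_smul, Real.norm_of_nonneg (by positivity), add_mul, one_mul,
          inv_mul_cancel_right₀ hyn.ne']
    have hrv : ‖r • v‖ = r := by rw [norm_smul, hv, mul_one, Real.norm_of_nonneg hr.le]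
    refine ⟨y + r • v, ?_, ?_, hyc _ ?_⟩
    · linarith [norm_nonneg y]
    · linarith [norm_add_le y (r • v)]
    · rw [add_sub_cancel_left, hrv]
  choose ps h1 h2 h3 using hps
  obtain ⟨p, hp, hpc⟩ := hepi.exists_le h1 h2 h3
  exact isAlphaClass_ofBase hconv (h.isBase_baseFn.baseInf_lt_of_epiConverges hu hepi) hrot
    (norm_pos_iff.1 (hr.trans_le hp)) (hpc.trans_lt hc)

end HypoSymmetrization

end MinkSymm

open MinkSymm
theorem lemma4p1 (n : ℕ) (hn : 0 < n) :
    -- every `ψ ∈ Conv_c(ℝⁿ)` has an epi-symmetrization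
    (∀ ψ : E n → EReal, IsConvC ψ →
      ∃ φ : E n → EReal, IsConvC φ ∧ RotationInvariant φ ∧
        ∃ u : ℕ → E n, (∀ i, ‖u i‖ = 1) ∧ EpiConverges (iterSymmetral u ψ) φ) ∧
    -- every `f ∈ C_α(ℝⁿ)` has a hypo-symmetrization; each one lies in `C_α(ℝⁿ)`, is rotation
    -- invariant and is the hypo-limit of successive `α`-Minkowski symmetrals of `f`
    (∀ (α : ℝ) (f : E n → ℝ), IsAlphaClass α f →
      (∃ g : E n → ℝ, IsHypoSymmetrization α f g) ∧
      ∀ g : E n → ℝ, IsHypoSymmetrization α f g →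
        IsAlphaClass α g ∧ RotationInvariant g ∧
          ∃ u : ℕ → E n, (∀ i, ‖u i‖ = 1) ∧ HypoConverges (iterAlphaSymmetral α u f) g) ∧
    -- the same for `α = 0` and `f ∈ LC_c(ℝⁿ)`, whose support may be lower-dimensional
    (∀ f : E n → ℝ, IsLCc f →
      (∃ g : E n → ℝ, IsHypoSymmetrization 0 f g) ∧
      ∀ g : E n → ℝ, IsHypoSymmetrization 0 f g →
        IsLCc g ∧ RotationInvariant g ∧
          ∃ u : ℕ → E n, (∀ i, ‖u i‖ = 1) ∧ HypoConverges (iterAlphaSymmetral 0 u f) g) := by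
  refine ⟨fun ψ hψ => exists_epiSymmetrization hn hψ, fun α f hf => ⟨?_, ?_⟩, ?_⟩
  · obtain ⟨φ, hφ⟩ := exists_epiSymmetrization hn hf.isConvC_baseFn
    exact ⟨_, φ, hφ, rfl⟩
  · rintro g ⟨φ, hφ, rfl⟩
    refine ⟨hf.of_epiSymmetrization hn hφ, rotationInvariant_ofBase hφ.2.1, ?_⟩
    obtain ⟨-, -, u, hu, hepi⟩ := hφ
    have := hf.isBase_baseFn.hypoConverges hu hepi
    rw [hf.ofBase_baseFn] at this
    exact ⟨u, hu, this⟩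
  · rintro f ⟨ψ, hψ, rfl⟩
    -- The base function of e^{-ψ} is ψ itself, so the claims reduce to those for ψ.
    simp only [IsHypoSymmetrization, hψ.isBase_zero.baseFn_ofBase]
    refine ⟨?_, ?_⟩
    · obtain ⟨φ, hφ⟩ := exists_epiSymmetrization hn hψ
      exact ⟨_, φ, hφ, rfl⟩
    · rintro g ⟨φ, hφ, rfl⟩
      refine ⟨⟨φ, hφ.1, rfl⟩, rotationInvariant_ofBase hφ.2.1, ?_⟩
      obtain ⟨-, -, u, hu, hepi⟩ := hφ
      exact ⟨u, hu, hψ.isBase_zero.hypoConverges hu hepi⟩
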